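/- For $n\ge 1$ let $\mathrm{Vol}(\mathrm{SO}_n(\mathbb R))$ be the total Riemannian volume of $\mathrm{SO}_n(\mathbb R)$ with respect to the invariant Riemannian metric induced from the trace form $(X,Y)\mapsto \mathrm{Tr}(XY^{\mathrm{tr}})$ on its Lie algebra, that is, $\langle X,Y\rangle_k=\mathrm{Tr}\big((k^{-1}X)(k^{-1}Y)^{\mathrm{tr}}\big)$ for $X,Y$ tangent to $\mathrm{SO}_n(\mathbb R)$ at $k$. Let $\mathrm{Vol}(S^{n-1})$ be the Riemannian volume of the unit sphere $S^{n-1}\subset\mathbb R^n$ with respect to the metric induced from the standard Euclidean metric of $\mathbb R^n$. Then for every $n\ge 2$ $$\mathrm{Vol}(\mathrm{SO}_n(\mathbb R))=\mathrm{Vol}(\mathrm{SO}_{n-1}(\mathbb R))\cdot \mathrm{Vol}(S^{n-1})\cdot 2^{\frac{n-1}{2}},$$ and consequently for every $n\ge 1$ $$\mathrm{Vol}(\mathrm{SO}_n(\mathbb R))=2^{\frac{n(n-1)}{4}}\prod_{k=2}^{n}\mathrm{Vol}(S^{k-1})=2^{\frac{n(n-1)}{4}}\prod_{k=2}^{n}\frac{2\pi^{k/2}}{\Gamma(k/2)},$$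 where for $n=1$ the products are empty and $\mathrm{SO}_1(\mathbb R)$ is a point, of volume $1$. -/

import Mathlib

open MeasureTheory Set
open scoped ContDiff ENNReal

noncomputable section

/- Matrix spaces are regarded as Euclidean spaces for `⟨X, Y⟩ = Tr (X Yᵀ)`; this is used only to
speak about differentiability and the (standard) topology. -/
attribute [local instance] Matrix.frobeniusNormedAddCommGroup Matrix.frobeniusNormedSpace

section RiemannianVolume

variable {E : Type*} [NormedAddCommGroup E] [NormedSpace ℝ E]

/-- `e` is (the inverse of) a smooth chart of the `d`-dimensional embedded submanifold `M ⊆ E`: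
a homeomorphism from an open subset of `ℝ ^ d` onto a (relatively) open subset of `M` which, as a
map into `E`, is smooth with injective derivative. -/
structure IsLocalParametrization {d : ℕ} {M : Set E}
    (e : OpenPartialHomeomorph (EuclideanSpace ℝ (Fin d)) M) : Prop where
  contDiffOn : ContDiffOn ℝ ∞ (fun x => (e x : E)) e.source
  injective_fderiv : ∀ x ∈ e.source, Function.Injective (fderiv ℝ (fun x => (e x : E)) x)

/-- The coefficient matrix `g_ij` of the metric `g` in the local coordinates given by `e`, at the
point with coordinates `x`: `g_ij = g_{e x} (∂_i e, ∂_j e)`. -/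
def metricMatrix {d : ℕ} {M : Set E} (g : E → E → E → ℝ)
    (e : OpenPartialHomeomorph (EuclideanSpace ℝ (Fin d)) M) (x : EuclideanSpace ℝ (Fin d)) :
    Matrix (Fin d) (Fin d) ℝ :=
  Matrix.of fun i j =>
    g (e x) (fderiv ℝ (fun y => (e y : E)) x (EuclideanSpace.single i 1))
      (fderiv ℝ (fun y => (e y : E)) x (EuclideanSpace.single j 1))

/-- The Riemannian volume measure, on the chart domain parametrized by `e`, of the metric `g`: the
measure `√(det g_ij) dx₁ ⋯ dx_d` on the source of `e`, transported to `M` (with its Borel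
`σ`-algebra). -/
def chartVolume {d : ℕ} {M : Set E} (g : E → E → E → ℝ)
    (e : OpenPartialHomeomorph (EuclideanSpace ℝ (Fin d)) M) : @Measure M (borel M) :=
  letI : MeasurableSpace M := borel M
  ((volume.restrict e.source).withDensity
    fun x => ENNReal.ofReal (√(metricMatrix g e x).det)).map e

/-- The Riemannian volume measure of a `d`-dimensional embedded submanifold `M ⊆ E` with Riemannian
metric `g` (`g p` is an inner product on the tangent space `T_p M ⊆ E`). It is the measure on `M`
given on every chart domain by `√(det g_ij) dx₁ ⋯ dx_d`, i.e. the supremum (in the lattice of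
measures) of these local measures, each of which is carried by its chart domain. -/
def riemannianMeasure (d : ℕ) (M : Set E) (g : E → E → E → ℝ) : @Measure M (borel M) :=
  ⨆ (e : OpenPartialHomeomorph (EuclideanSpace ℝ (Fin d)) M) (_ : IsLocalParametrization e),
    chartVolume g e

/-- The total Riemannian volume of the `d`-dimensional submanifold `M` with metric `g`. -/
def riemannianVolume (d : ℕ) (M : Set E) (g : E → E → E → ℝ) : ℝ≥0∞ :=
  riemannianMeasure d M g univ

end RiemannianVolume

/-- The trace form `(X, Y) ↦ Tr (X Yᵀ)`. -/
def traceForm {n : ℕ} (X Y : Matrix (Fin n) (Fin n) ℝ) : ℝ := (X * Y.transpose).trace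

/-- The invariant Riemannian metric induced by the trace form on the Lie algebra: tangent vectors
`X`, `Y` at `k` are translated to the identity, `g_k (X, Y) = Tr ((k⁻¹ X) (k⁻¹ Y)ᵀ)`. -/
def traceMetric {n : ℕ} (k X Y : Matrix (Fin n) (Fin n) ℝ) : ℝ := traceForm (k⁻¹ * X) (k⁻¹ * Y)

/-- `Vol (SO_n(ℝ))` for the metric induced from the trace form; `dim SO_n(ℝ) = n (n - 1) / 2`. -/
def volSO (n : ℕ) : ℝ≥0∞ :=
  riemannianVolume (n * (n - 1) / 2)
    (Matrix.specialOrthogonalGroup (Fin n) ℝ : Set (Matrix (Fin n) (Fin n) ℝ)) traceMetric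

/-- `Vol (S^m)`, the volume of the unit sphere `S^m ⊆ ℝ^(m+1)` for the metric induced from the
standard Euclidean metric. -/
def volSphere (m : ℕ) : ℝ≥0∞ :=
  riemannianVolume m (Metric.sphere (0 : EuclideanSpace ℝ (Fin (m + 1))) 1)
    fun _ X Y => inner ℝ X Y

end

open Filter Topology

noncomputable section

attribute [local instance] Matrix.frobeniusNormedAddCommGroup Matrix.frobeniusNormedSpace

/-! ### Riemannian measure of a submanifold: independence of charts and localization. -/

section Generic

/-! Let `e` be the last basis vector of ℝ^(m+1). The map k ↦ k e fibres SO_{m+1} over S^m with fibre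
SO_m, and up to scale it is a Riemannian submersion. A skew matrix is determined by its upper left
corner, which is the fibre direction, and its last column, which is the base direction. Its last row
is minus that column, so the trace form is the trace form of the corner plus twice the Euclidean
product of the columns (`traceForm_eq_corner_add_lastCol`). Each of the m base directions is thus
stretched by √2, whence the factor 2^(m/2).

Concretely, a section s of the fibration over the sphere minus a point gives coordinates (x, h) ↦
s(x) diag(h, 1). In them the metric is twice the sphere metric in dx plus the metric of SO_m in dh,
after a shear dh ↦ dh + B dx caused by the motion of s along the fibres
(`exists_traceForm_productChartDeriv`). A shear has determinant one, so the Gram determinant is a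
product (`det_metricMatrix_productChart`) and Tonelli splits the chart volume
(`chartVolume_productChart`).

To globalize, measures are compared on open covers (`Measure.ext_of_forall_open_cover`), first along
the fibre (`riemannianMeasure_SO_preimage`), then along the base (`volSO_succ`); inside a single
chart domain the Riemannian measure is the chart volume
(`riemannianMeasure_apply_of_subset_target`). Induction from the point SO_1 gives the product
formula.

The sphere factors come from polar coordinates: the Riemannian measure is the cone measure
`toSphere` (`chartVolume_sphere`), whose mass is read off from the volume of the ball. -/

theorem ContinuousOn.measurableSet_inter_preimage {X Y : Type*} [TopologicalSpace X]
    [MeasurableSpace X] [BorelSpace X] [TopologicalSpace Y] [MeasurableSpace Y] [BorelSpace Y]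
    {f : X → Y} {s : Set X} (hf : ContinuousOn f s) (hs : MeasurableSet s) {t : Set Y}
    (ht : MeasurableSet t) : MeasurableSet (s ∩ f ⁻¹' t) := by
  have h := (MeasurableEmbedding.subtype_coe hs).measurableSet_image.2
    (hf.domRestrict.measurable ht)
  convert h using 1
  ext x
  simp
  tauto

/-- A subset of a normed space with its Borel `σ`-algebra. -/
@[reducible] def borelSubtype {E : Type*} [TopologicalSpace E] (M : Set E) : MeasurableSpace M :=
  borel M

attribute [local instance] borelSubtype

theorem borelSpace_borelSubtype {E : Type*} [TopologicalSpace E] (M : Set E) : BorelSpace M := ⟨rfl⟩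

attribute [local instance] borelSpace_borelSubtype

variable {E : Type*} [NormedAddCommGroup E] [NormedSpace ℝ E]

/-- A continuous map which becomes differentiable after composition with an immersion is
differentiable. -/
theorem ContinuousAt.differentiableAt_of_comp_immersion [FiniteDimensional ℝ E]
    {V W : Type*} [NormedAddCommGroup V] [NormedSpace ℝ V] [NormedAddCommGroup W] [NormedSpace ℝ W]
    [FiniteDimensional ℝ W] {f : W → E} {φ : V → W} {x : V}
    (hφ : ContinuousAt φ x) (hf : ContDiffAt ℝ ∞ f (φ x))
    (hinj : Function.Injective (fderiv ℝ f (φ x)))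
    (h : DifferentiableAt ℝ (f ∘ φ) x) : DifferentiableAt ℝ φ x := by
  have : CompleteSpace W := FiniteDimensional.complete ℝ W
  -- With `P` a left inverse of the differential, `P ∘ f` has derivative the identity, so it has a
  -- differentiable local inverse; near `x`, `φ` is that inverse applied to `P ∘ (f ∘ φ)`.
  obtain ⟨P, hP⟩ := LinearMap.exists_leftInverse_of_injective
    (fderiv ℝ f (φ x) : W →ₗ[ℝ] E) (LinearMap.ker_eq_bot.2 hinj)
  have hfs : HasStrictFDerivAt f (fderiv ℝ f (φ x)) (φ x) := hf.hasStrictFDerivAt (by simp)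
  have hPf : HasStrictFDerivAt (fun z => P.toContinuousLinearMap (f z))
      ((ContinuousLinearEquiv.refl ℝ W : W ≃L[ℝ] W) : W →L[ℝ] W) (φ x) := by
    have := P.toContinuousLinearMap.hasStrictFDerivAt.comp (φ x) hfs
    convert this using 1
    ext w
    simpa using (LinearMap.congr_fun hP w).symm
  have hG := hPf.to_localInverse
  have hev := hφ.eventually hPf.eventually_left_inverse
  have hd : DifferentiableAt ℝ (fun z => P.toContinuousLinearMap ((f ∘ φ) z)) x :=
    P.toContinuousLinearMap.differentiableAt.comp x h
  have hd2 := DifferentiableAt.comp x (f := fun z => P.toContinuousLinearMap ((f ∘ φ) z))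
    hG.differentiableAt hd
  exact hd2.congr_of_eventuallyEq (hev.mono fun z hz => hz.symm)

variable {d : ℕ} {M : Set E}

theorem IsLocalParametrization.contDiffAt {e : OpenPartialHomeomorph (EuclideanSpace ℝ (Fin d)) M}
    (he : IsLocalParametrization e) {x : EuclideanSpace ℝ (Fin d)} (hx : x ∈ e.source) :
    ContDiffAt ℝ ∞ (fun x => (e x : E)) x :=
  he.contDiffOn.contDiffAt (e.open_source.mem_nhds hx)

theorem IsLocalParametrization.hasFDerivAt {e : OpenPartialHomeomorph (EuclideanSpace ℝ (Fin d)) M}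
    (he : IsLocalParametrization e) {x : EuclideanSpace ℝ (Fin d)} (hx : x ∈ e.source) :
    HasFDerivAt (fun x => (e x : E)) (fderiv ℝ (fun x => (e x : E)) x) x :=
  ((he.contDiffAt hx).differentiableAt (by simp)).hasFDerivAt

theorem IsLocalParametrization.differentiableAt_transition [FiniteDimensional ℝ E]
    {e e' : OpenPartialHomeomorph (EuclideanSpace ℝ (Fin d)) M}
    (he : IsLocalParametrization e) (he' : IsLocalParametrization e')
    {x : EuclideanSpace ℝ (Fin d)} (hx : x ∈ e.source) (hx' : e x ∈ e'.target) :
    DifferentiableAt ℝ (fun z => e'.symm (e z)) x := by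
  have hcont : ContinuousAt (fun z => e'.symm (e z)) x :=
    (e'.continuousAt_symm hx').comp (e.continuousAt hx)
  refine hcont.differentiableAt_of_comp_immersion (f := fun x => (e' x : E))
    (he'.contDiffAt (e'.map_target hx')) (he'.injective_fderiv _ (e'.map_target hx')) ?_
  refine ((he.contDiffAt hx).differentiableAt (by simp)).congr_of_eventuallyEq ?_
  filter_upwards [(e.continuousAt hx).preimage_mem_nhds (e'.open_target.mem_nhds hx')] with z hz
  simp [e'.right_inv hz]

/-- The Gram matrix of the images of the standard basis. -/
def gramMatrix (b : E → E → ℝ) (L : EuclideanSpace ℝ (Fin d) →L[ℝ] E) : Matrix (Fin d) (Fin d) ℝ :=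
  Matrix.of fun i j => b (L (EuclideanSpace.single i 1)) (L (EuclideanSpace.single j 1))

theorem metricMatrix_eq_gramMatrix (g : E → E → E → ℝ)
    (e : OpenPartialHomeomorph (EuclideanSpace ℝ (Fin d)) M) (x : EuclideanSpace ℝ (Fin d)) :
    metricMatrix g e x = gramMatrix (g (e x)) (fderiv ℝ (fun y => (e y : E)) x) := rfl

theorem EuclideanSpace.eq_sum_single (x : EuclideanSpace ℝ (Fin d)) :
    x = ∑ i, x i • EuclideanSpace.single i (1 : ℝ) := by
  ext j
  simp [Finset.sum_apply, Pi.single_apply]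

/-- The Gram matrix transforms as `Pᵀ G P`. After a square root this produces exactly the Jacobian
`|det A|` of the change of variables formula. -/
theorem det_gramMatrix_comp (b : LinearMap.BilinForm ℝ E) (L : EuclideanSpace ℝ (Fin d) →L[ℝ] E)
    (A : EuclideanSpace ℝ (Fin d) →L[ℝ] EuclideanSpace ℝ (Fin d)) :
    (gramMatrix (fun X Y => b X Y) (L.comp A)).det =
      A.det ^ 2 * (gramMatrix (fun X Y => b X Y) L).det := by
  set P : Matrix (Fin d) (Fin d) ℝ :=
    Matrix.of fun i j => (A (EuclideanSpace.single j 1)) i with hP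
  have hAdet : A.det = P.det := by
    rw [ContinuousLinearMap.det, ← LinearMap.det_toMatrix (EuclideanSpace.basisFun (Fin d) ℝ).toBasis]
    congr 1
  have hmul : gramMatrix (fun X Y => b X Y) (L.comp A) =
      P.transpose * gramMatrix (fun X Y => b X Y) L * P := by
    ext i j
    have h1 : ∀ j, L (A (EuclideanSpace.single j 1)) =
        ∑ k, P k j • L (EuclideanSpace.single k 1) := by
      intro j
      conv_lhs => rw [EuclideanSpace.eq_sum_single (A (EuclideanSpace.single j 1))]
      simp [hP]
    simp only [gramMatrix, ContinuousLinearMap.comp_apply, Matrix.of_apply, h1, Matrix.mul_apply,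
      Matrix.transpose_apply, map_sum, map_smul, LinearMap.sum_apply, LinearMap.smul_apply,
      smul_eq_mul, Finset.sum_mul, Finset.mul_sum]
    refine Finset.sum_congr rfl fun k _ => Finset.sum_congr rfl fun l _ => ?_
    ring
  rw [hmul, Matrix.det_mul, Matrix.det_mul, Matrix.det_transpose, hAdet]
  ring

theorem chartVolume_apply {g : E → E → E → ℝ}
    (e : OpenPartialHomeomorph (EuclideanSpace ℝ (Fin d)) M) {S : Set M} (hS : MeasurableSet S) :
    chartVolume g e S = ∫⁻ x in e.source ∩ e ⁻¹' S, ENNReal.ofReal (√(metricMatrix g e x).det) := by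
  have hm : MeasurableSet e.source := e.open_source.measurableSet
  have hmeas : AEMeasurable e (volume.restrict e.source) := e.continuousOn.aemeasurable hm
  have hpre : MeasurableSet (e.source ∩ e ⁻¹' S) := e.continuousOn.measurableSet_inter_preimage hm hS
  unfold chartVolume
  rw [Measure.map_apply_of_aemeasurable (hmeas.mono_ac (withDensity_absolutelyContinuous _ _)) hS,
    ← measure_inter_add_sdiff₀ (t := e.source) _ hm.nullMeasurableSet]
  -- The values of `e` off its source are arbitrary, but the measure being pushed forward does not
  -- charge that set.
  have h0 : ((volume.restrict e.source).withDensity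
      fun x => ENNReal.ofReal (√(metricMatrix g e x).det)) (e ⁻¹' S \ e.source) = 0 := by
    refine withDensity_absolutelyContinuous _ _ ?_
    exact measure_mono_null (t := e.sourceᶜ) (fun x hx => hx.2)
      (by rw [Measure.restrict_apply hm.compl]; simp)
  rw [h0, add_zero, inter_comm, withDensity_apply _ hpre, Measure.restrict_restrict hpre,
    inter_eq_left.2 inter_subset_left]

/-- The Jacobian of the transition map cancels against the change of the Gram determinant. Assuming
that `g` is one fixed bilinear form along `M` loses nothing here: it holds for the sphere by
definition and for SO_n by `traceMetric_eq_traceBilin`. -/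
theorem chartVolume_congr [FiniteDimensional ℝ E] {g : E → E → E → ℝ}
    {b : LinearMap.BilinForm ℝ E} (hg : ∀ p ∈ M, ∀ X Y, g p X Y = b X Y)
    {e e' : OpenPartialHomeomorph (EuclideanSpace ℝ (Fin d)) M}
    (he : IsLocalParametrization e) (he' : IsLocalParametrization e')
    {S : Set M} (hS : MeasurableSet S) (hSe : S ⊆ e.target) (hSe' : S ⊆ e'.target) :
    chartVolume g e S = chartVolume g e' S := by
  set D := e.source ∩ e ⁻¹' S with hD
  set φ := fun z => e'.symm (e z) with hφ
  have himg : e'.source ∩ e' ⁻¹' S = φ '' D := by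
    ext y
    constructor
    · rintro ⟨hy, hyS⟩
      have : e' y ∈ e.target := hSe hyS
      refine ⟨e.symm (e' y), ⟨e.map_target this, by simpa [e.right_inv this] using hyS⟩, ?_⟩
      simp [hφ, e.right_inv this, e'.left_inv hy]
    · rintro ⟨x, ⟨hx, hxS⟩, rfl⟩
      have : e x ∈ e'.target := hSe' hxS
      exact ⟨e'.map_target this, by simpa [hφ, e'.right_inv this] using hxS⟩
  have hdiff : ∀ x ∈ D, DifferentiableAt ℝ φ x := fun x hx =>
    he.differentiableAt_transition he' hx.1 (hSe' hx.2)
  have hinj : InjOn φ D := by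
    intro x hx y hy hxy
    have h1 : e x = e y := e'.symm.injOn (hSe' hx.2) (hSe' hy.2) hxy
    exact e.injOn hx.1 hy.1 h1
  have hDm : MeasurableSet D := e.continuousOn.measurableSet_inter_preimage e.open_source.measurableSet hS
  rw [chartVolume_apply e hS, chartVolume_apply e' hS, himg,
    lintegral_image_eq_lintegral_abs_det_fderiv_mul volume hDm
      (fun x hx => (hdiff x hx).hasFDerivAt.hasFDerivWithinAt) hinj]
  refine setLIntegral_congr_fun hDm fun x hx => ?_
  have hxt : e x ∈ e'.target := hSe' hx.2
  have hpt : e' (φ x) = e x := e'.right_inv hxt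
  have hfd : fderiv ℝ (fun y => (e y : E)) x =
      (fderiv ℝ (fun y => (e' y : E)) (φ x)).comp (fderiv ℝ φ x) := by
    have h1 := (he'.hasFDerivAt (e'.map_target hxt)).comp x (hdiff x hx).hasFDerivAt
    refine (h1.congr_of_eventuallyEq ?_).fderiv
    filter_upwards [(e.continuousAt hx.1).preimage_mem_nhds (e'.open_target.mem_nhds hxt)] with z hz
    simp [hφ, e'.right_inv hz]
  have hb' : g (e x) = fun X Y => b X Y := by ext X Y; exact hg _ (e x).2 X Y
  simp only [metricMatrix_eq_gramMatrix, hpt, hfd, hb', det_gramMatrix_comp]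
  rw [Real.sqrt_mul (sq_nonneg _), Real.sqrt_sq_eq_abs, ENNReal.ofReal_mul (abs_nonneg _)]

/-- Supplies the measurability of the density that Tonelli requires. -/
theorem IsLocalParametrization.continuousOn_sqrt_det_metricMatrix [FiniteDimensional ℝ E]
    {g : E → E → E → ℝ} {b : LinearMap.BilinForm ℝ E} (hg : ∀ p ∈ M, ∀ X Y, g p X Y = b X Y)
    {e : OpenPartialHomeomorph (EuclideanSpace ℝ (Fin d)) M} (he : IsLocalParametrization e) :
    ContinuousOn (fun x => √(metricMatrix g e x).det) e.source := by
  have hfd : ContinuousOn (fderiv ℝ (fun x => (e x : E))) e.source :=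
    he.contDiffOn.continuousOn_fderiv_of_isOpen e.open_source (by simp)
  have hb : Continuous fun p : E × E => b p.1 p.2 := by
    have h : Continuous fun X : E => (b X).toContinuousLinearMap :=
      (LinearMap.toContinuousLinearMap.toLinearMap ∘ₗ b).continuous_of_finiteDimensional
    exact (h.comp continuous_fst).clm_apply continuous_snd
  have hmat : ∀ x, metricMatrix g e x =
      gramMatrix (fun X Y => b X Y) (fderiv ℝ (fun y => (e y : E)) x) := by
    intro x
    ext i j
    exact hg _ (e x).2 _ _
  simp only [hmat]
  refine Real.continuous_sqrt.comp_continuousOn (Continuous.comp_continuousOn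
    (g := Matrix.det) (Continuous.matrix_det continuous_id) ?_)
  refine continuousOn_pi.2 fun i => continuousOn_pi.2 fun j => ?_
  exact hb.comp_continuousOn ((hfd.clm_apply continuousOn_const).prodMk
    (hfd.clm_apply continuousOn_const))

theorem chartVolume_inter_target {g : E → E → E → ℝ}
    (e : OpenPartialHomeomorph (EuclideanSpace ℝ (Fin d)) M) {S : Set M} (hS : MeasurableSet S) :
    chartVolume g e S = chartVolume g e (S ∩ e.target) := by
  rw [chartVolume_apply e hS, chartVolume_apply e (hS.inter e.open_target.measurableSet)]
  congr 2
  ext x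
  simp only [mem_inter_iff, mem_preimage]
  exact ⟨fun h => ⟨h.1, h.2, e.map_source h.1⟩, fun h => ⟨h.1, h.2.1⟩⟩

theorem riemannianMeasure_apply_of_subset_target [FiniteDimensional ℝ E] {g : E → E → E → ℝ}
    {b : LinearMap.BilinForm ℝ E} (hg : ∀ p ∈ M, ∀ X Y, g p X Y = b X Y)
    {e : OpenPartialHomeomorph (EuclideanSpace ℝ (Fin d)) M} (he : IsLocalParametrization e)
    {S : Set M} (hS : MeasurableSet S) (hSe : S ⊆ e.target) :
    riemannianMeasure d M g S = chartVolume g e S := by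
  refine le_antisymm ?_ ?_
  -- A supremum of measures is not computed set by set, so it is bounded by a measure dominating
  -- every chart: `chartVolume g e` on the target of `e`, and the supremum itself off it. The second
  -- term vanishes on `S`.
  · have hle : riemannianMeasure d M g ≤
        chartVolume g e + (riemannianMeasure d M g).restrict e.targetᶜ := by
      refine iSup₂_le fun e' he' => Measure.le_iff.2 fun T hT => ?_
      have hm : MeasurableSet e.target := e.open_target.measurableSet
      rw [← measure_inter_add_sdiff T hm, Measure.add_apply]
      refine add_le_add ?_ ?_
      · rw [chartVolume_inter_target e' (hT.inter hm)]
        rw [← chartVolume_congr hg he he' ((hT.inter hm).inter e'.open_target.measurableSet)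
          (fun x hx => hx.1.2) inter_subset_right]
        exact measure_mono fun x hx => hx.1.1
      · rw [Measure.restrict_apply hT, ← sdiff_eq]
        exact Measure.le_iff.1 (le_iSup₂ (f := fun (e : OpenPartialHomeomorph
          (EuclideanSpace ℝ (Fin d)) M) (_ : IsLocalParametrization e) => chartVolume g e) e' he')
          _ (hT.diff hm)
    refine (Measure.le_iff.1 hle S hS).trans ?_
    rw [Measure.add_apply, Measure.restrict_apply hS]
    have : S ∩ e.targetᶜ = ∅ := by
      rw [← sdiff_eq, sdiff_eq_empty]; exact hSe
    simp [this]
  · exact Measure.le_iff.1 (le_iSup₂ (f := fun (e : OpenPartialHomeomorph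
      (EuclideanSpace ℝ (Fin d)) M) (_ : IsLocalParametrization e) => chartVolume g e) e he) S hS

/-- Measures on a second countable space which agree locally are equal. -/
theorem MeasureTheory.Measure.ext_of_forall_open_cover {X : Type*} [TopologicalSpace X]
    [SecondCountableTopology X] [MeasurableSpace X] [BorelSpace X] {μ ν : Measure X}
    (U : X → Set X) (hU : ∀ x, IsOpen (U x)) (hxU : ∀ x, x ∈ U x)
    (h : ∀ x, ∀ S ⊆ U x, MeasurableSet S → μ S = ν S) : μ = ν := by
  obtain ⟨s, hs, hsU⟩ := TopologicalSpace.countable_cover_nhds fun x => (hU x).mem_nhds (hxU x)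
  have := hs.to_subtype
  refine (Measure.ext_iff_of_iUnion_eq_univ (s := fun x : s => U x) ?_).2 fun x => ?_
  · rw [← hsU, biUnion_eq_iUnion]
  · ext S hS
    rw [Measure.restrict_apply hS, Measure.restrict_apply hS]
    exact h x _ inter_subset_right (hS.inter (hU x).measurableSet)

end Generic

attribute [local instance] borelSubtype borelSpace_borelSubtype

/-! ### Splitting of Lebesgue measure and of Gram determinants. -/

section Gram

/-- The splitting `ℝ^(p+q) ≃ ℝ^p × ℝ^q`. -/
def euclideanSplit (p q : ℕ) :
    EuclideanSpace ℝ (Fin (p + q)) ≃L[ℝ] EuclideanSpace ℝ (Fin p) × EuclideanSpace ℝ (Fin q) :=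
  EuclideanSpace.finAddEquivProd

variable {p q : ℕ}

theorem euclideanSplit_single_castAdd (i : Fin p) :
    euclideanSplit p q (EuclideanSpace.single (Fin.castAdd q i) 1) =
      (EuclideanSpace.single i 1, 0) := by
  ext j <;> simp [euclideanSplit, EuclideanSpace.finAddEquivProd, EuclideanSpace.sumEquivProd]

theorem euclideanSplit_single_natAdd (i : Fin q) :
    euclideanSplit p q (EuclideanSpace.single (Fin.natAdd p i) 1) =
      (0, EuclideanSpace.single i 1) := by
  ext j <;> simp [euclideanSplit, EuclideanSpace.finAddEquivProd, EuclideanSpace.sumEquivProd]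

theorem measurePreserving_euclideanSplit : MeasurePreserving (euclideanSplit p q) :=
  (WithLp.volume_preserving_ofLp _ _).comp
    ((PiLp.sumPiLpEquivProdLpPiLp 2 fun _ : Fin p ⊕ Fin q => ℝ).measurePreserving.comp
      (LinearIsometryEquiv.piLpCongrLeft 2 ℝ ℝ finSumFinEquiv.symm).measurePreserving)

theorem setLIntegral_euclideanSplit {X : Set (EuclideanSpace ℝ (Fin p))}
    {Y : Set (EuclideanSpace ℝ (Fin q))} {f : EuclideanSpace ℝ (Fin p) → ℝ≥0∞}
    {g : EuclideanSpace ℝ (Fin q) → ℝ≥0∞}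
    (hf : AEMeasurable f (volume.restrict X)) (hg : AEMeasurable g (volume.restrict Y)) :
    ∫⁻ z in euclideanSplit p q ⁻¹' (X ×ˢ Y),
        f (euclideanSplit p q z).1 * g (euclideanSplit p q z).2 =
      (∫⁻ x in X, f x) * ∫⁻ y in Y, g y := by
  rw [measurePreserving_euclideanSplit.setLIntegral_comp_preimage_emb
    (euclideanSplit p q).toHomeomorph.measurableEmbedding (fun z => f z.1 * g z.2) (X ×ˢ Y),
    Measure.volume_eq_prod, ← Measure.prod_restrict, lintegral_prod_mul hf hg]

theorem gramMatrix_inner_id :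
    gramMatrix (fun x y => inner ℝ x y) (.id ℝ (EuclideanSpace ℝ (Fin p))) = 1 := by
  ext i j
  simp only [gramMatrix, Matrix.of_apply, ContinuousLinearMap.id_apply,
    EuclideanSpace.inner_single_left, Matrix.one_apply]
  simp

theorem sq_det_eq_det_gramMatrix
    (L : EuclideanSpace ℝ (Fin p) →L[ℝ] EuclideanSpace ℝ (Fin p)) :
    L.det ^ 2 = (gramMatrix (fun x y => inner ℝ x y) L).det := by
  have h := det_gramMatrix_comp (innerₗ (EuclideanSpace ℝ (Fin p))) (.id ℝ _) L
  simp only [innerₗ_apply_apply, gramMatrix_inner_id] at h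
  rw [ContinuousLinearMap.id_comp] at h
  simp [h]

/-- The Gram determinant of a form on `ℝ^p × ℝ^q` which is block diagonal up to a shear. -/
theorem det_gramMatrix_of_shear
    (c : EuclideanSpace ℝ (Fin (p + q)) → EuclideanSpace ℝ (Fin (p + q)) → ℝ)
    (α : LinearMap.BilinForm ℝ (EuclideanSpace ℝ (Fin p)))
    (β : LinearMap.BilinForm ℝ (EuclideanSpace ℝ (Fin q)))
    (B : EuclideanSpace ℝ (Fin p) →ₗ[ℝ] EuclideanSpace ℝ (Fin q))
    (h : ∀ x y, c x y = α (euclideanSplit p q x).1 (euclideanSplit p q y).1 +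
      β ((euclideanSplit p q x).2 + B (euclideanSplit p q x).1)
        ((euclideanSplit p q y).2 + B (euclideanSplit p q y).1)) :
    (gramMatrix c (.id ℝ _)).det =
      (gramMatrix (fun x y => α x y) (.id ℝ _)).det *
        (gramMatrix (fun x y => β x y) (.id ℝ _)).det := by
  set Ga := gramMatrix (fun x y => α x y) (.id ℝ _) with hGa
  set Gb := gramMatrix (fun x y => β x y) (.id ℝ _) with hGb
  set P : Matrix (Fin q) (Fin p) ℝ := Matrix.of fun i j => B (EuclideanSpace.single j 1) i with hP
  have hB : ∀ j, B (EuclideanSpace.single j 1) = ∑ k, P k j • EuclideanSpace.single k (1 : ℝ) :=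
    fun j => EuclideanSpace.eq_sum_single _
  -- The shear appears as unipotent block triangular factors on both sides of the block diagonal
  -- Gram matrix; their determinants are one.
  have key : (gramMatrix c (.id ℝ _)).submatrix finSumFinEquiv finSumFinEquiv =
      (Matrix.fromBlocks 1 P.transpose 0 1) * Matrix.fromBlocks Ga 0 0 Gb *
        Matrix.fromBlocks 1 0 P 1 := by
    rw [Matrix.fromBlocks_multiply, Matrix.fromBlocks_multiply]
    ext (i | i) (j | j)
    · simp only [hGa, hGb, gramMatrix, h, Matrix.submatrix_apply, finSumFinEquiv_apply_left,
        Matrix.of_apply, ContinuousLinearMap.id_apply, euclideanSplit_single_castAdd, hB]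
      simp [Matrix.mul_apply, Finset.sum_mul, Finset.mul_sum]
      refine Finset.sum_congr rfl fun k _ => Finset.sum_congr rfl fun l _ => ?_
      ring
    · simp only [hGa, hGb, gramMatrix, h, Matrix.submatrix_apply, finSumFinEquiv_apply_left,
        finSumFinEquiv_apply_right, euclideanSplit_single_natAdd,
        Matrix.of_apply, ContinuousLinearMap.id_apply, euclideanSplit_single_castAdd, hB]
      simp [Matrix.mul_apply]
    · simp only [hGa, hGb, gramMatrix, h, Matrix.submatrix_apply, finSumFinEquiv_apply_left,
        finSumFinEquiv_apply_right, euclideanSplit_single_natAdd,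
        Matrix.of_apply, ContinuousLinearMap.id_apply, euclideanSplit_single_castAdd, hB]
      simp [Matrix.mul_apply, mul_comm]
    · simp only [hGb, gramMatrix, h, Matrix.submatrix_apply,
        finSumFinEquiv_apply_right, euclideanSplit_single_natAdd,
        Matrix.of_apply, ContinuousLinearMap.id_apply]
      simp
  have hdet := congrArg Matrix.det key
  rw [Matrix.det_submatrix_equiv_self, Matrix.det_mul, Matrix.det_mul,
    Matrix.det_fromBlocks_zero₁₂, Matrix.det_fromBlocks_zero₁₂, Matrix.det_fromBlocks_zero₂₁] at hdet
  simpa using hdet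

end Gram

open scoped Pointwise

/-! ### The Riemannian volume of the sphere through polar coordinates. -/

section Sphere

/-- The unit sphere of `ℝ^(m+1)`. -/
abbrev unitSphere (m : ℕ) : Set (EuclideanSpace ℝ (Fin (m + 1))) :=
  Metric.sphere (0 : EuclideanSpace ℝ (Fin (m + 1))) 1

variable {m : ℕ}

/-- The inverse of the stereographic projection from `f`. -/
def sphereChart (f : unitSphere m) :
    OpenPartialHomeomorph (EuclideanSpace ℝ (Fin m)) (unitSphere m) :=
  have := Fact.mk (@finrank_euclideanSpace_fin ℝ _ (m + 1))
  (stereographic' m f).symm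

@[simp] theorem sphereChart_source (f : unitSphere m) : (sphereChart f).source = univ := by
  simp [sphereChart]

@[simp] theorem sphereChart_target (f : unitSphere m) : (sphereChart f).target = {f}ᶜ := by
  simp [sphereChart]

theorem isLocalParametrization_sphereChart (f : unitSphere m) :
    IsLocalParametrization (sphereChart f) := by
  have := Fact.mk (@finrank_euclideanSpace_fin ℝ _ (m + 1))
  let U : (Submodule.span ℝ {(f : EuclideanSpace ℝ (Fin (m + 1)))})ᗮ ≃ₗᵢ[ℝ]
      EuclideanSpace ℝ (Fin m) :=
    (OrthonormalBasis.fromOrthogonalSpanSingleton m (ne_zero_of_mem_unit_sphere f)).repr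
  have hsm : ContDiff ℝ ∞ (fun x => (sphereChart f x : EuclideanSpace ℝ (Fin (m + 1)))) :=
    (contDiff_stereoInvFunAux (v := (f : EuclideanSpace ℝ (Fin (m + 1))))).comp
      ((Submodule.subtypeL _).contDiff.comp U.symm.contDiff)
  refine ⟨hsm.contDiffOn, fun x _ => ?_⟩
  set y := sphereChart f x with hy
  have hyf : y ≠ f := by
    have : y ∈ (sphereChart f).target := (sphereChart f).map_source (by simp)
    simpa using this
  have hinner : (y : EuclideanSpace ℝ (Fin (m + 1))) ∈
      {z | innerSL ℝ (f : EuclideanSpace ℝ (Fin (m + 1))) z ≠ (1 : ℝ)} := by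
    intro h
    exact hyf ((sphere_ext_iff y f).2 (by rw [real_inner_comm]; exact h))
  have hopen : IsOpen {z | innerSL ℝ (f : EuclideanSpace ℝ (Fin (m + 1))) z ≠ (1 : ℝ)} :=
    isOpen_ne.preimage (innerSL ℝ (f : EuclideanSpace ℝ (Fin (m + 1)))).continuous
  have hd : DifferentiableAt ℝ (fun z => U (stereoToFun
      (f : EuclideanSpace ℝ (Fin (m + 1))) z)) (y : EuclideanSpace ℝ (Fin (m + 1))) :=
    U.differentiableAt.comp _ (((contDiffOn_stereoToFun (n := 1)).contDiffAt
      (hopen.mem_nhds hinner)).differentiableAt (by simp))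
  -- Stereographic projection is a differentiable left inverse of the chart, which forces the
  -- derivative of the chart to be injective.
  have hcomp := hd.hasFDerivAt.comp x (hsm.differentiable (by simp) x).hasFDerivAt
  have hid : (fun z => U (stereoToFun (f : EuclideanSpace ℝ (Fin (m + 1))) z)) ∘
      (fun x => (sphereChart f x : EuclideanSpace ℝ (Fin (m + 1)))) = id := by
    ext1 z
    exact (stereographic' m f).right_inv (by simp)
  rw [hid] at hcomp
  have h1 := hcomp.unique (hasFDerivAt_id x)
  intro v w hvw
  have hv := congrArg (fun L => L v) h1
  have hw := congrArg (fun L => L w) h1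
  simp only [ContinuousLinearMap.comp_apply, ContinuousLinearMap.id_apply] at hv hw
  rw [← hv, ← hw, hvw]

theorem inner_fderiv_of_norm_eq_one {V W : Type*} [NormedAddCommGroup V] [NormedSpace ℝ V]
    [NormedAddCommGroup W] [InnerProductSpace ℝ W] {u : V → W} {u' : V →L[ℝ] W} {x : V}
    (h : HasFDerivAt u u' x) (h1 : ∀ᶠ z in 𝓝 x, ‖u z‖ = 1) (v : V) : inner ℝ (u x) (u' v) = 0 := by
  have h2 := h.inner ℝ h
  have h3 : HasFDerivAt (fun z => inner ℝ (u z) (u z)) (0 : V →L[ℝ] ℝ) x := by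
    refine (hasFDerivAt_const (1 : ℝ) x).congr_of_eventuallyEq ?_
    filter_upwards [h1] with z hz
    rw [real_inner_self_eq_norm_sq, hz, one_pow]
  have h4 := congrArg (fun L => L v) (h2.unique h3)
  simp only [ContinuousLinearMap.comp_apply, ContinuousLinearMap.prod_apply,
    fderivInnerCLM_apply, _root_.zero_apply, real_inner_comm (u x)] at h4
  linarith

theorem setLIntegral_pow_euclideanSpace_fin_one (m : ℕ) :
    ∫⁻ w in {w : EuclideanSpace ℝ (Fin 1) | w 0 ∈ Ioo (0 : ℝ) 1}, ENNReal.ofReal (w 0 ^ m) =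
      ENNReal.ofReal (1 / (m + 1)) := by
  have hmp : MeasurePreserving (fun w : EuclideanSpace ℝ (Fin 1) => w 0) :=
    (volume_preserving_funUnique (Fin 1) ℝ).comp (PiLp.volume_preserving_ofLp (Fin 1))
  have h1 := hmp.setLIntegral_comp_preimage measurableSet_Ioo (s := Ioo (0 : ℝ) 1)
    (f := fun t => ENNReal.ofReal (t ^ m)) (by fun_prop)
  refine h1.trans ?_
  change ∫⁻ b : ℝ in Ioo 0 1, ENNReal.ofReal (b ^ m) = _
  rw [Measure.restrict_congr_set Ioo_ae_eq_Ioc, ← ofReal_integral_eq_lintegral_ofReal,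
    ← intervalIntegral.integral_of_le zero_le_one]
  · simp
  · exact (intervalIntegral.intervalIntegrable_pow m).1
  · filter_upwards [ae_restrict_mem measurableSet_Ioc] with t ht
    exact pow_nonneg ht.1.le _

/-- The Riemannian metric of the sphere. -/
abbrev sphereMetric (m : ℕ) (_ X Y : EuclideanSpace ℝ (Fin (m + 1))) : ℝ := inner ℝ X Y

theorem inner_smul_add_smul_of_orthogonal {W : Type*} [NormedAddCommGroup W]
    [InnerProductSpace ℝ W] {w X Y : W} (hw : ‖w‖ = 1) (hX : inner ℝ w X = 0)
    (hY : inner ℝ w Y = 0) (s a b : ℝ) :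
    inner ℝ (s • X + a • w) (s • Y + b • w) = s ^ 2 * inner ℝ X Y + a * b := by
  have hX' : inner ℝ X w = 0 := by rw [real_inner_comm, hX]
  simp only [inner_add_left, inner_add_right, real_inner_smul_left, real_inner_smul_right, hX',
    hY, real_inner_self_eq_norm_sq, hw]
  ring

/-- `toSphere S` is `m + 1` times the Lebesgue volume of the cone (0,1)·S. The polar map (x, t) ↦ t
u(x) parametrizes that cone with Jacobian t^m √(det g), and ∫₀¹ t^m dt = 1/(m+1) cancels the factor.
-/
theorem chartVolume_sphere {e : OpenPartialHomeomorph (EuclideanSpace ℝ (Fin m)) (unitSphere m)}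
    (he : IsLocalParametrization e) {S : Set (unitSphere m)} (hS : MeasurableSet S)
    (hSe : S ⊆ e.target) :
    chartVolume (sphereMetric m) e S =
      (volume : Measure (EuclideanSpace ℝ (Fin (m + 1)))).toSphere S := by
  have hg : ∀ p ∈ unitSphere m, ∀ X Y, sphereMetric m p X Y =
      innerₗ (EuclideanSpace ℝ (Fin (m + 1))) X Y := fun _ _ _ _ => rfl
  have hS' : @MeasurableSet _ Subtype.instMeasurableSpace S := by
    rw [(inferInstance : @BorelSpace (unitSphere m) _ Subtype.instMeasurableSpace).measurable_eq]
    exact hS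
  set u : EuclideanSpace ℝ (Fin m) → EuclideanSpace ℝ (Fin (m + 1)) := fun x => e x with hu
  set D₀ := e.source ∩ e ⁻¹' S with hD₀
  have hD₀m : MeasurableSet D₀ :=
    e.continuousOn.measurableSet_inter_preimage e.open_source.measurableSet hS
  set I : Set (EuclideanSpace ℝ (Fin 1)) := {w | w 0 ∈ Ioo (0 : ℝ) 1} with hI
  have hIm : MeasurableSet I := by
    have : Measurable fun w : EuclideanSpace ℝ (Fin 1) => w 0 := by fun_prop
    exact this measurableSet_Ioo
  set D := euclideanSplit m 1 ⁻¹' (D₀ ×ˢ I) with hD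
  have hDm : MeasurableSet D := (euclideanSplit m 1).continuous.measurable (hD₀m.prod hIm)
  let π₁ : EuclideanSpace ℝ (Fin (m + 1)) →L[ℝ] EuclideanSpace ℝ (Fin m) :=
    (ContinuousLinearMap.fst ℝ _ _).comp (euclideanSplit m 1).toContinuousLinearMap
  let τ : EuclideanSpace ℝ (Fin (m + 1)) →L[ℝ] ℝ :=
    (EuclideanSpace.proj (𝕜 := ℝ) (0 : Fin 1)).comp
      ((ContinuousLinearMap.snd ℝ _ _).comp (euclideanSplit m 1).toContinuousLinearMap)
  have hπ₁ : ∀ z, π₁ z = (euclideanSplit m 1 z).1 := fun _ => rfl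
  have hτ : ∀ z, τ z = (euclideanSplit m 1 z).2 0 := fun _ => rfl
  let F : EuclideanSpace ℝ (Fin (m + 1)) → EuclideanSpace ℝ (Fin (m + 1)) :=
    fun z => τ z • u (π₁ z)
  let F' : EuclideanSpace ℝ (Fin (m + 1)) →
      EuclideanSpace ℝ (Fin (m + 1)) →L[ℝ] EuclideanSpace ℝ (Fin (m + 1)) :=
    fun z => τ z • (fderiv ℝ u (π₁ z)).comp π₁ + τ.smulRight (u (π₁ z))
  have hF' : ∀ z ∈ D, HasFDerivWithinAt F (F' z) D z := fun z hz =>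
    (τ.hasFDerivAt.smul ((he.hasFDerivAt (x := π₁ z) hz.1.1).comp z π₁.hasFDerivAt)).hasFDerivWithinAt
  have hunorm : ∀ x, ‖u x‖ = 1 := fun x => norm_eq_of_mem_sphere (e x)
  have hinj : InjOn F D := by
    intro z hz w hw hzw
    have hz2 : τ z ∈ Ioo (0 : ℝ) 1 := hz.2
    have hw2 : τ w ∈ Ioo (0 : ℝ) 1 := hw.2
    have h1 : τ z = τ w := by
      have := congrArg norm hzw
      simpa [F, norm_smul, hunorm, abs_of_pos hz2.1, abs_of_pos hw2.1] using this
    have h2 : u (π₁ z) = u (π₁ w) := by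
      have : τ z • u (π₁ z) = τ z • u (π₁ w) := by
        calc _ = F w := hzw
          _ = _ := by rw [h1]
      exact smul_right_injective _ hz2.1.ne' this
    have h3 : π₁ z = π₁ w := e.injOn hz.1.1 hw.1.1 (Subtype.ext h2)
    apply (euclideanSplit m 1).injective
    refine Prod.ext h3 ?_
    ext i
    rw [Subsingleton.elim i 0]
    exact h1
  have himg : F '' D = Ioo (0 : ℝ) 1 • (Subtype.val '' S) := by
    ext y
    simp only [mem_image, Set.mem_smul]
    constructor
    · rintro ⟨z, hz, rfl⟩
      exact ⟨τ z, hz.2, u (π₁ z), ⟨e (π₁ z), hz.1.2, rfl⟩, rfl⟩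
    · rintro ⟨t, ht, _, ⟨s, hs, rfl⟩, rfl⟩
      have hst := hSe hs
      refine ⟨(euclideanSplit m 1).symm (e.symm s, EuclideanSpace.single 0 t), ?_, ?_⟩
      · simp only [hD, mem_preimage, ContinuousLinearEquiv.apply_symm_apply, mem_prod, hD₀, hI]
        refine ⟨⟨e.map_target hst, ?_⟩, ?_⟩
        · simpa [e.right_inv hst] using hs
        · simpa using ht
      · simp [F, hτ, hπ₁, hu, e.right_inv hst]
  have hdet : ∀ z ∈ D, |(F' z).det| =
      √(metricMatrix (sphereMetric m) e (π₁ z)).det * (τ z) ^ m := by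
    intro z hz
    have hz2 : τ z ∈ Ioo (0 : ℝ) 1 := hz.2
    have hperp : ∀ v, inner ℝ (u (π₁ z)) (fderiv ℝ u (π₁ z) v) = 0 :=
      inner_fderiv_of_norm_eq_one (he.hasFDerivAt hz.1.1) (Eventually.of_forall hunorm)
    -- The shear is zero: `u` is a unit vector, hence orthogonal to its derivatives, and the radial
    -- and tangential directions do not mix.
    have hb := det_gramMatrix_of_shear (fun x y => inner ℝ (F' z x) (F' z y))
      ((τ z ^ 2) • (innerₗ (EuclideanSpace ℝ (Fin (m + 1)))).compl₁₂
        (fderiv ℝ u (π₁ z) : _ →ₗ[ℝ] _) (fderiv ℝ u (π₁ z) : _ →ₗ[ℝ] _))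
      (innerₗ (EuclideanSpace ℝ (Fin 1))) 0 (by
        intro x y
        have h2 : inner ℝ (F' z x) (F' z y) = τ z ^ 2 * inner ℝ (fderiv ℝ u (π₁ z) (π₁ x))
            (fderiv ℝ u (π₁ z) (π₁ y)) + τ x * τ y :=
          inner_smul_add_smul_of_orthogonal (hunorm _) (hperp _) (hperp _) _ _ _
        have h3 : inner ℝ (euclideanSplit m 1 x).2 (euclideanSplit m 1 y).2 = τ x * τ y := by
          rw [hτ, hτ, PiLp.inner_apply, Fin.sum_univ_one]
          exact mul_comm _ _
        rw [h2, ← h3]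
        simp only [LinearMap.smul_apply, LinearMap.compl₁₂_apply, LinearMap.zero_apply, add_zero,
          smul_eq_mul, innerₗ_apply_apply, ContinuousLinearMap.coe_coe]
        rfl)
    have h1 : (F' z).det ^ 2 = (τ z ^ m) ^ 2 * (metricMatrix (sphereMetric m) e (π₁ z)).det := by
      rw [sq_det_eq_det_gramMatrix]
      have h2 : gramMatrix (fun x y => inner ℝ x y) (F' z) =
        gramMatrix (fun x y => inner ℝ (F' z x) (F' z y)) (.id ℝ _) := rfl
      rw [h2]
      refine hb.trans ?_
      have h3 : gramMatrix (fun x y => innerₗ (EuclideanSpace ℝ (Fin 1)) x y) (.id ℝ _) = 1 :=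
        gramMatrix_inner_id
      have h4 : gramMatrix (fun x y => ((τ z ^ 2) • (innerₗ (EuclideanSpace ℝ (Fin (m + 1)))).compl₁₂
        (fderiv ℝ u (π₁ z) : _ →ₗ[ℝ] _) (fderiv ℝ u (π₁ z) : _ →ₗ[ℝ] _)) x y) (.id ℝ _) =
          (τ z ^ 2) • metricMatrix (sphereMetric m) e (π₁ z) := by
        ext i j
        rfl
      rw [h3, h4, Matrix.det_smul, Fintype.card_fin, Matrix.det_one]
      ring
    rw [← Real.sqrt_sq_eq_abs, h1, Real.sqrt_mul (sq_nonneg _), Real.sqrt_sq (pow_nonneg hz2.1.le _),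
      mul_comm]
  rw [Measure.toSphere_apply' _ hS', ← himg,
    ← lintegral_abs_det_fderiv_eq_addHaar_image volume hDm hF' hinj,
    setLIntegral_congr_fun hDm (g := fun z =>
      ENNReal.ofReal √(metricMatrix (sphereMetric m) e (euclideanSplit m 1 z).1).det *
        ENNReal.ofReal ((euclideanSplit m 1 z).2 0 ^ m))
      (fun z hz => by
        simp only [hdet z hz]
        rw [ENNReal.ofReal_mul (Real.sqrt_nonneg _)]
        rfl)]
  rw [setLIntegral_euclideanSplit (p := m) (q := 1)
    (f := fun x => ENNReal.ofReal √(metricMatrix (sphereMetric m) e x).det)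
    (g := fun w => ENNReal.ofReal (w 0 ^ m))
    (((he.continuousOn_sqrt_det_metricMatrix hg).mono inter_subset_left).aemeasurable
      hD₀m).ennreal_ofReal (by fun_prop), setLIntegral_pow_euclideanSpace_fin_one,
    ← chartVolume_apply e hS]
  rw [mul_comm (chartVolume _ _ _), ← mul_assoc, ← ENNReal.ofReal_natCast,
    ← ENNReal.ofReal_mul (by positivity)]
  simp only [finrank_euclideanSpace, Fintype.card_fin]
  rw [Nat.cast_add_one, mul_one_div_cancel (by positivity), ENNReal.ofReal_one, one_mul]

/-- `toSphere` lives on the subspace `σ`-algebra and `riemannianMeasure` on the Borel one. The two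
are equal by a theorem, so the measure has to be transported. -/
theorem MeasureTheory.Measure.exists_forall_apply_eq {X : Type*} {m₁ m₂ : MeasurableSpace X}
    (h : m₁ = m₂) (μ : @Measure X m₁) : ∃ ν : @Measure X m₂, ∀ S, ν S = μ S := by
  subst h
  exact ⟨μ, fun _ => rfl⟩

theorem volSphere_eq_toSphere (m : ℕ) :
    volSphere m = (volume : Measure (EuclideanSpace ℝ (Fin (m + 1)))).toSphere univ := by
  have hg : ∀ p ∈ unitSphere m, ∀ X Y, sphereMetric m p X Y =
      innerₗ (EuclideanSpace ℝ (Fin (m + 1))) X Y := fun _ _ _ _ => rfl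
  obtain ⟨ν, hν⟩ := Measure.exists_forall_apply_eq
    ((inferInstance : @BorelSpace (unitSphere m) _ Subtype.instMeasurableSpace).measurable_eq)
    (volume : Measure (EuclideanSpace ℝ (Fin (m + 1)))).toSphere
  have key : riemannianMeasure m (unitSphere m) (sphereMetric m) = ν := by
    -- Projecting from the antipode `-x` gives a chart whose domain contains `x`.
    refine Measure.ext_of_forall_open_cover (fun x => (sphereChart (-x)).target)
      (fun x => (sphereChart (-x)).open_target) (fun x => ?_) fun x S hS hSm => ?_
    · simpa using ne_neg_of_mem_unit_sphere ℝ x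
    · have he := isLocalParametrization_sphereChart (-x)
      rw [riemannianMeasure_apply_of_subset_target hg he hSm hS, chartVolume_sphere he hSm hS, hν]
  rw [← hν, ← key]
  rfl

theorem volSphere_eq (m : ℕ) :
    volSphere m = ENNReal.ofReal
      (2 * Real.pi ^ (((m + 1 : ℕ) : ℝ) / 2) / Real.Gamma (((m + 1 : ℕ) : ℝ) / 2)) := by
  rw [volSphere_eq_toSphere, Measure.toSphere_apply_univ, EuclideanSpace.volume_ball]
  simp only [finrank_euclideanSpace, Fintype.card_fin, ENNReal.ofReal_one, one_pow, one_mul]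
  rw [← ENNReal.ofReal_natCast, ← ENNReal.ofReal_mul (by positivity)]
  congr 1
  have hpos : (0 : ℝ) < ((m + 1 : ℕ) : ℝ) / 2 := by positivity
  -- The ball has Γ(a + 1) = a Γ(a) in the denominator, with a = (m+1)/2; dividing the factor `m +
  -- 1` by `a` leaves the 2.
  rw [Real.Gamma_add_one hpos.ne', Real.sqrt_eq_rpow, ← Real.rpow_natCast, ← Real.rpow_mul
    Real.pi_pos.le]
  have := (Real.Gamma_pos_of_pos hpos).ne'
  rw [show 1 / 2 * ((m + 1 : ℕ) : ℝ) = ((m + 1 : ℕ) : ℝ) / 2 by ring]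
  field_simp

end Sphere

open Matrix

/-- The topology of the Frobenius norm. -/
@[reducible] def frobeniusTopology (m n : Type*) [Fintype m] [Fintype n] :
    TopologicalSpace (Matrix m n ℝ) :=
  (Matrix.frobeniusNormedAddCommGroup : NormedAddCommGroup (Matrix m n ℝ)).toPseudoMetricSpace.toUniformSpace.toTopologicalSpace

attribute [local instance] frobeniusTopology

/-! ### Calculus of matrix-valued maps. -/

section MatrixCalculus

variable {V : Type*} [NormedAddCommGroup V] [NormedSpace ℝ V] {n : ℕ}

theorem contDiffAt_matrix {k : ℕ∞ω} {f : V → Matrix (Fin n) (Fin n) ℝ} {x : V}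
    (h : ∀ i j, ContDiffAt ℝ k (fun x => f x i j) x) : ContDiffAt ℝ k f x := by
  let L : (Fin n → Fin n → ℝ) →L[ℝ] Matrix (Fin n) (Fin n) ℝ :=
    (Matrix.ofLinearEquiv ℝ : (Fin n → Fin n → ℝ) ≃ₗ[ℝ] _).toLinearMap.toContinuousLinearMap
  exact L.contDiff.contDiffAt.comp x
    (contDiffAt_pi.2 fun i => contDiffAt_pi.2 fun j => h i j)

/-- Multiplication of matrices as a continuous bilinear map. -/
def matrixMulCLM (n : ℕ) : Matrix (Fin n) (Fin n) ℝ →L[ℝ] Matrix (Fin n) (Fin n) ℝ →L[ℝ]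
    Matrix (Fin n) (Fin n) ℝ :=
  (LinearMap.toContinuousLinearMap.toLinearMap ∘ₗ
    LinearMap.mul ℝ (Matrix (Fin n) (Fin n) ℝ)).toContinuousLinearMap

theorem HasFDerivAt.matrix_mul {f g : V → Matrix (Fin n) (Fin n) ℝ}
    {f' g' : V →L[ℝ] Matrix (Fin n) (Fin n) ℝ} {x : V}
    (hf : HasFDerivAt f f' x) (hg : HasFDerivAt g g' x) :
    HasFDerivAt (fun z => f z * g z)
      ((matrixMulCLM n (f x)).comp g' + ((matrixMulCLM n).flip (g x)).comp f') x := by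
  have h := (matrixMulCLM n).hasFDerivAt_of_bilinear hf hg
  exact h.congr_fderiv (by ext1 v; rfl)

/-- Transposition as a continuous linear map. -/
def transposeCLM (n : ℕ) : Matrix (Fin n) (Fin n) ℝ →L[ℝ] Matrix (Fin n) (Fin n) ℝ :=
  (Matrix.transposeLinearEquiv (Fin n) (Fin n) ℝ ℝ).toLinearMap.toContinuousLinearMap

/-- Left translates to the identity of tangent vectors to the orthogonal group are skew. -/
theorem transpose_mul_fderiv_skew {f : V → Matrix (Fin n) (Fin n) ℝ}
    {f' : V →L[ℝ] Matrix (Fin n) (Fin n) ℝ} {x : V} (hf : HasFDerivAt f f' x)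
    (h : ∀ᶠ z in 𝓝 x, (f z)ᵀ * f z = 1) (v : V) :
    ((f x)ᵀ * f' v)ᵀ = -((f x)ᵀ * f' v) := by
  have h1 := ((transposeCLM n).hasFDerivAt.comp x hf).matrix_mul hf
  have h2 : HasFDerivAt (fun z => (transposeCLM n ∘ f) z * f z)
      (0 : V →L[ℝ] Matrix (Fin n) (Fin n) ℝ) x :=
    (hasFDerivAt_const (1 : Matrix (Fin n) (Fin n) ℝ) x).congr_of_eventuallyEq h
  have h3 : (f x)ᵀ * f' v + (f' v)ᵀ * f x = 0 := congrArg (fun L => L v) (h1.unique h2)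
  rw [transpose_mul, transpose_transpose]
  exact eq_neg_of_add_eq_zero_right h3

/-- Right translates to the identity of tangent vectors to the orthogonal group are skew. -/
theorem fderiv_mul_transpose_skew {f : V → Matrix (Fin n) (Fin n) ℝ}
    {f' : V →L[ℝ] Matrix (Fin n) (Fin n) ℝ} {x : V} (hf : HasFDerivAt f f' x)
    (h : ∀ᶠ z in 𝓝 x, f z * (f z)ᵀ = 1) (v : V) :
    (f' v * (f x)ᵀ)ᵀ = -(f' v * (f x)ᵀ) := by
  have h1 := hf.matrix_mul ((transposeCLM n).hasFDerivAt.comp x hf)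
  have h2 : HasFDerivAt (fun z => f z * (transposeCLM n ∘ f) z)
      (0 : V →L[ℝ] Matrix (Fin n) (Fin n) ℝ) x :=
    (hasFDerivAt_const (1 : Matrix (Fin n) (Fin n) ℝ) x).congr_of_eventuallyEq h
  have h3 : f x * (f' v)ᵀ + f' v * (f x)ᵀ = 0 := congrArg (fun L => L v) (h1.unique h2)
  rw [transpose_mul, transpose_transpose]
  exact eq_neg_of_add_eq_zero_left h3

end MatrixCalculus

/-! ### The trace form, SO_n and skew matrices. -/

section Orthogonal

variable {n : ℕ}

/-- `SO_n(ℝ)` as a set of matrices. -/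
abbrev SO (n : ℕ) : Set (Matrix (Fin n) (Fin n) ℝ) :=
  (Matrix.specialOrthogonalGroup (Fin n) ℝ : Set (Matrix (Fin n) (Fin n) ℝ))

theorem mem_SO_iff {k : Matrix (Fin n) (Fin n) ℝ} : k ∈ SO n ↔ kᵀ * k = 1 ∧ k.det = 1 := by
  rw [SetLike.mem_coe, mem_specialOrthogonalGroup_iff, mem_orthogonalGroup_iff']

theorem SO.transpose_mul {k : Matrix (Fin n) (Fin n) ℝ} (hk : k ∈ SO n) : kᵀ * k = 1 :=
  (mem_SO_iff.1 hk).1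

theorem SO.mul_transpose {k : Matrix (Fin n) (Fin n) ℝ} (hk : k ∈ SO n) : k * kᵀ = 1 :=
  mul_eq_one_comm.1 (SO.transpose_mul hk)

theorem SO.mul_mem {k l : Matrix (Fin n) (Fin n) ℝ} (hk : k ∈ SO n) (hl : l ∈ SO n) :
    k * l ∈ SO n := (Matrix.specialOrthogonalGroup (Fin n) ℝ).mul_mem hk hl

theorem SO.transpose_mem {k : Matrix (Fin n) (Fin n) ℝ} (hk : k ∈ SO n) : kᵀ ∈ SO n := by
  rw [mem_SO_iff, transpose_transpose, det_transpose]
  exact ⟨SO.mul_transpose hk, (mem_SO_iff.1 hk).2⟩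

/-- The trace form as a bilinear form. -/
def traceBilin (n : ℕ) : LinearMap.BilinForm ℝ (Matrix (Fin n) (Fin n) ℝ) :=
  LinearMap.mk₂ ℝ traceForm (by simp [traceForm, add_mul]) (by simp [traceForm])
    (by simp [traceForm, mul_add]) (by simp [traceForm])

theorem traceBilin_apply (X Y : Matrix (Fin n) (Fin n) ℝ) : traceBilin n X Y = traceForm X Y := rfl

theorem traceForm_eq_sum (X Y : Matrix (Fin n) (Fin n) ℝ) :
    traceForm X Y = ∑ i, ∑ j, X i j * Y i j := by
  simp [traceForm, trace, mul_apply]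

theorem traceForm_self_eq_zero {X : Matrix (Fin n) (Fin n) ℝ} (h : traceForm X X = 0) : X = 0 := by
  rw [traceForm_eq_sum] at h
  ext i j
  have h1 := (Finset.sum_eq_zero_iff_of_nonneg
    (fun i _ => Finset.sum_nonneg fun j _ => mul_self_nonneg (X i j))).1 h i (Finset.mem_univ _)
  have h2 := (Finset.sum_eq_zero_iff_of_nonneg
    (fun j _ => mul_self_nonneg (X i j))).1 h1 j (Finset.mem_univ _)
  simpa using h2

theorem traceForm_self_nonneg (X : Matrix (Fin n) (Fin n) ℝ) : 0 ≤ traceForm X X := by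
  rw [traceForm_eq_sum]
  exact Finset.sum_nonneg fun i _ => Finset.sum_nonneg fun j _ => mul_self_nonneg _

theorem traceForm_mul_right {k : Matrix (Fin n) (Fin n) ℝ} (hk : k * kᵀ = 1)
    (X Y : Matrix (Fin n) (Fin n) ℝ) : traceForm (X * k) (Y * k) = traceForm X Y := by
  rw [traceForm, traceForm, transpose_mul, Matrix.mul_assoc, ← Matrix.mul_assoc k, hk,
    Matrix.one_mul]

theorem traceForm_mul_left {k : Matrix (Fin n) (Fin n) ℝ} (hk : kᵀ * k = 1)
    (X Y : Matrix (Fin n) (Fin n) ℝ) : traceForm (k * X) (k * Y) = traceForm X Y := by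
  rw [traceForm, traceForm, transpose_mul, ← Matrix.mul_assoc, trace_mul_comm,
    Matrix.mul_assoc k, ← Matrix.mul_assoc, hk, Matrix.one_mul]

/-- Left multiplication by an orthogonal matrix preserves the trace form, so the invariant metric is
just the ambient Euclidean one restricted to SO_n. -/
theorem traceMetric_eq_traceBilin : ∀ k ∈ SO n, ∀ X Y : Matrix (Fin n) (Fin n) ℝ,
    traceMetric k X Y = traceBilin n X Y := by
  intro k hk X Y
  have h : k⁻¹ = kᵀ := inv_eq_left_inv (SO.transpose_mul hk)
  rw [traceMetric, h, traceBilin_apply]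
  exact traceForm_mul_left (by rw [transpose_transpose, SO.mul_transpose hk]) X Y

/-- The skew-symmetric matrices. -/
def skewSubmodule (n : ℕ) : Submodule ℝ (Matrix (Fin n) (Fin n) ℝ) where
  carrier := {X | Xᵀ = -X}
  add_mem' := by
    intro X Y hX hY
    simp only [mem_ofPred_eq] at *
    rw [transpose_add, hX, hY]; abel
  zero_mem' := by simp
  smul_mem' := by
    intro c X hX
    simp only [mem_ofPred_eq] at *
    rw [transpose_smul, hX, smul_neg]

theorem mem_skewSubmodule {X : Matrix (Fin n) (Fin n) ℝ} : X ∈ skewSubmodule n ↔ Xᵀ = -X := Iff.rfl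

theorem skew_apply {X : Matrix (Fin n) (Fin n) ℝ} (hX : Xᵀ = -X) (i j : Fin n) :
    X j i = -X i j := congrFun (congrFun hX i) j

/-- A skew matrix is determined by its entries strictly below the diagonal. The upper bound is
enough: charts of SO_n inject ℝ^(n(n-1)/2) into this space. -/
theorem finrank_skewSubmodule_le (n : ℕ) :
    Module.finrank ℝ (skewSubmodule n) ≤ n * (n - 1) / 2 := by
  let T : skewSubmodule n →ₗ[ℝ] ((Σ i : Fin n, Fin i) → ℝ) :=
    { toFun := fun X p => X.1 p.1 (p.2.castLE p.1.2.le)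
      map_add' := fun X Y => rfl
      map_smul' := fun c X => rfl }
  have hT : Function.Injective T := by
    rw [← LinearMap.ker_eq_bot, LinearMap.ker_eq_bot']
    intro X hX
    have hlt : ∀ i j : Fin n, j < i → X.1 i j = 0 := fun i j hij =>
      congrFun hX ⟨i, ⟨j, hij⟩⟩
    ext i j
    rcases lt_trichotomy i j with h | h | h
    · rw [skew_apply X.2 j i, hlt j i h]; simp
    · subst h
      have := skew_apply X.2 i i
      simp only [ZeroMemClass.coe_zero, Matrix.zero_apply]
      linarith
    · simpa using hlt i j h
  have h := LinearMap.finrank_le_finrank_of_injective hT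
  rw [Module.finrank_fintype_fun_eq_card, Fintype.card_sigma] at h
  simpa [Fin.sum_univ_eq_sum_range (fun i => i) n, Finset.sum_range_id] using h

end Orthogonal

/-! ### The inclusion of SO_m in SO_{m+1} as a stabilizer. -/

section Embedding

variable {m : ℕ}

/-- The block diagonal matrix `diag (h, c)`. -/
def cornerBlock (h : Matrix (Fin m) (Fin m) ℝ) (c : ℝ) : Matrix (Fin (m + 1)) (Fin (m + 1)) ℝ :=
  (fromBlocks h 0 0 (c • (1 : Matrix (Fin 1) (Fin 1) ℝ))).submatrix
    finSumFinEquiv.symm finSumFinEquiv.symm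

@[simp] theorem cornerBlock_castSucc_castSucc (h : Matrix (Fin m) (Fin m) ℝ) (c : ℝ)
    (i j : Fin m) : cornerBlock h c i.castSucc j.castSucc = h i j := by
  simp [cornerBlock]

@[simp] theorem cornerBlock_castSucc_last (h : Matrix (Fin m) (Fin m) ℝ) (c : ℝ) (i : Fin m) :
    cornerBlock h c i.castSucc (Fin.last m) = 0 := by
  simp [cornerBlock]

@[simp] theorem cornerBlock_last_castSucc (h : Matrix (Fin m) (Fin m) ℝ) (c : ℝ) (i : Fin m) :
    cornerBlock h c (Fin.last m) i.castSucc = 0 := by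
  simp [cornerBlock]

@[simp] theorem cornerBlock_last_last (h : Matrix (Fin m) (Fin m) ℝ) (c : ℝ) :
    cornerBlock h c (Fin.last m) (Fin.last m) = c := by
  simp [cornerBlock]

theorem ext_castSucc_last {X Y : Matrix (Fin (m + 1)) (Fin (m + 1)) ℝ}
    (h₁ : ∀ i j : Fin m, X i.castSucc j.castSucc = Y i.castSucc j.castSucc)
    (h₂ : ∀ i : Fin m, X i.castSucc (Fin.last m) = Y i.castSucc (Fin.last m))
    (h₃ : ∀ i : Fin m, X (Fin.last m) i.castSucc = Y (Fin.last m) i.castSucc)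
    (h₄ : X (Fin.last m) (Fin.last m) = Y (Fin.last m) (Fin.last m)) : X = Y := by
  ext i j
  induction i using Fin.lastCases <;> induction j using Fin.lastCases <;> simp [*]

theorem cornerBlock_mul (h k : Matrix (Fin m) (Fin m) ℝ) (c d : ℝ) :
    cornerBlock h c * cornerBlock k d = cornerBlock (h * k) (c * d) := by
  apply ext_castSucc_last <;> simp [mul_apply, Fin.sum_univ_castSucc]

theorem cornerBlock_add (h k : Matrix (Fin m) (Fin m) ℝ) (c d : ℝ) :
    cornerBlock (h + k) (c + d) = cornerBlock h c + cornerBlock k d := by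
  apply ext_castSucc_last <;> simp

theorem cornerBlock_smul (r : ℝ) (h : Matrix (Fin m) (Fin m) ℝ) (c : ℝ) :
    cornerBlock (r • h) (r * c) = r • cornerBlock h c := by
  apply ext_castSucc_last <;> simp

theorem cornerBlock_transpose (h : Matrix (Fin m) (Fin m) ℝ) (c : ℝ) :
    (cornerBlock h c)ᵀ = cornerBlock hᵀ c := by
  apply ext_castSucc_last <;> simp

theorem cornerBlock_one : cornerBlock (1 : Matrix (Fin m) (Fin m) ℝ) 1 = 1 := by
  apply ext_castSucc_last <;> simp [one_apply, Fin.castSucc_ne_last, (Fin.castSucc_ne_last _).symm]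

theorem det_cornerBlock (h : Matrix (Fin m) (Fin m) ℝ) (c : ℝ) :
    (cornerBlock h c).det = h.det * c := by
  rw [cornerBlock, det_submatrix_equiv_self, det_fromBlocks_zero₁₂]
  simp

theorem cornerBlock_mem_SO {h : Matrix (Fin m) (Fin m) ℝ} (hh : h ∈ SO m) :
    cornerBlock h 1 ∈ SO (m + 1) := by
  rw [mem_SO_iff, cornerBlock_transpose, cornerBlock_mul, SO.transpose_mul hh, mul_one,
    cornerBlock_one, det_cornerBlock, (mem_SO_iff.1 hh).2, mul_one]
  exact ⟨rfl, rfl⟩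

/-- The linear map `h ↦ diag (h, 0)`. -/
def cornerBlockCLM (m : ℕ) :
    Matrix (Fin m) (Fin m) ℝ →L[ℝ] Matrix (Fin (m + 1)) (Fin (m + 1)) ℝ :=
  LinearMap.toContinuousLinearMap
    { toFun := fun h => cornerBlock h 0
      map_add' := fun X Y => by rw [← cornerBlock_add, add_zero]
      map_smul' := fun c X => by rw [RingHom.id_apply, ← cornerBlock_smul, mul_zero] }

theorem cornerBlockCLM_apply (h : Matrix (Fin m) (Fin m) ℝ) :
    cornerBlockCLM m h = cornerBlock h 0 := rfl

theorem cornerBlock_one_eq (h : Matrix (Fin m) (Fin m) ℝ) :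
    cornerBlock h 1 = cornerBlockCLM m h + cornerBlock 0 1 := by
  rw [cornerBlockCLM_apply, ← cornerBlock_add, add_zero, zero_add]

/-- The upper left corner of a matrix. -/
def cornerCLM (m : ℕ) : Matrix (Fin (m + 1)) (Fin (m + 1)) ℝ →L[ℝ] Matrix (Fin m) (Fin m) ℝ :=
  LinearMap.toContinuousLinearMap
    { toFun := fun X => X.submatrix Fin.castSucc Fin.castSucc
      map_add' := fun _ _ => rfl
      map_smul' := fun _ _ => rfl }

/-- The last column of a matrix. -/
def lastColCLM (m : ℕ) :
    Matrix (Fin (m + 1)) (Fin (m + 1)) ℝ →L[ℝ] EuclideanSpace ℝ (Fin (m + 1)) :=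
  LinearMap.toContinuousLinearMap
    { toFun := fun X => WithLp.toLp 2 fun i => X i (Fin.last m)
      map_add' := fun _ _ => rfl
      map_smul' := fun _ _ => rfl }

theorem cornerCLM_apply (X : Matrix (Fin (m + 1)) (Fin (m + 1)) ℝ) (i j : Fin m) :
    cornerCLM m X i j = X i.castSucc j.castSucc := rfl

theorem lastColCLM_apply (X : Matrix (Fin (m + 1)) (Fin (m + 1)) ℝ) (i : Fin (m + 1)) :
    lastColCLM m X i = X i (Fin.last m) := rfl

@[simp] theorem cornerCLM_cornerBlock (h : Matrix (Fin m) (Fin m) ℝ) (c : ℝ) :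
    cornerCLM m (cornerBlock h c) = h := by
  ext i j
  simp [cornerCLM_apply]

theorem lastColCLM_cornerBlock (h : Matrix (Fin m) (Fin m) ℝ) (c : ℝ) :
    lastColCLM m (cornerBlock h c) = EuclideanSpace.single (Fin.last m) c := by
  ext i
  induction i using Fin.lastCases <;>
    simp [lastColCLM_apply, Fin.castSucc_ne_last]

theorem lastColCLM_mul (X Y : Matrix (Fin (m + 1)) (Fin (m + 1)) ℝ) :
    lastColCLM m (X * Y) = WithLp.toLp 2 (X *ᵥ lastColCLM m Y) := by
  ext i
  rfl

theorem lastColCLM_mul_cornerBlock (X : Matrix (Fin (m + 1)) (Fin (m + 1)) ℝ)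
    (h : Matrix (Fin m) (Fin m) ℝ) : lastColCLM m (X * cornerBlock h 1) = lastColCLM m X := by
  ext i
  simp [lastColCLM_apply, mul_apply, Fin.sum_univ_castSucc]

theorem inner_lastColCLM (X Y : Matrix (Fin (m + 1)) (Fin (m + 1)) ℝ) :
    inner ℝ (lastColCLM m X) (lastColCLM m Y) = (Xᵀ * Y) (Fin.last m) (Fin.last m) := by
  simp [PiLp.inner_apply, lastColCLM_apply, mul_apply, mul_comm]

theorem norm_lastColCLM_of_mem_SO {k : Matrix (Fin (m + 1)) (Fin (m + 1)) ℝ} (hk : k ∈ SO (m + 1)) :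
    ‖lastColCLM m k‖ = 1 := by
  have h := inner_lastColCLM k k
  rw [SO.transpose_mul hk, one_apply_eq, real_inner_self_eq_norm_sq] at h
  exact (pow_eq_one_iff_of_nonneg (norm_nonneg _) two_ne_zero).1 h

theorem inner_mulVec_of_orthogonal {n : ℕ} {k : Matrix (Fin n) (Fin n) ℝ} (hk : kᵀ * k = 1)
    (v w : EuclideanSpace ℝ (Fin n)) :
    inner ℝ (WithLp.toLp 2 (k *ᵥ v) : EuclideanSpace ℝ (Fin n))
      (WithLp.toLp 2 (k *ᵥ w) : EuclideanSpace ℝ (Fin n)) = inner ℝ v w := by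
  rw [EuclideanSpace.inner_eq_star_dotProduct, EuclideanSpace.inner_eq_star_dotProduct]
  simp only [star_trivial]
  rw [dotProduct_mulVec, vecMul_mulVec, hk]
  simp

/-- The trace form on skew matrices in terms of the upper left corner and the last column. -/
theorem traceForm_eq_corner_add_lastCol {X Y : Matrix (Fin (m + 1)) (Fin (m + 1)) ℝ}
    (hX : Xᵀ = -X) (hY : Yᵀ = -Y) :
    traceForm X Y = traceForm (cornerCLM m X) (cornerCLM m Y) +
      2 * inner ℝ (lastColCLM m X) (lastColCLM m Y) := by
  have h0 : X (Fin.last m) (Fin.last m) = 0 := by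
    have := skew_apply hX (Fin.last m) (Fin.last m)
    linarith
  -- By skewness the last row repeats the last column up to sign, so those products are counted
  -- twice: this is the origin of the powers of 2.
  have hX' : ∀ i : Fin m, X (Fin.last m) i.castSucc = -X i.castSucc (Fin.last m) :=
    fun i => skew_apply hX _ _
  have hY' : ∀ i : Fin m, Y (Fin.last m) i.castSucc = -Y i.castSucc (Fin.last m) :=
    fun i => skew_apply hY _ _
  simp only [traceForm_eq_sum, Fin.sum_univ_castSucc, cornerCLM_apply, PiLp.inner_apply,
    lastColCLM_apply, h0, Finset.sum_add_distrib, hX', hY']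
  simp [mul_comm]
  ring

/-- The stabilizer of the last basis vector. -/
theorem eq_cornerBlock_of_lastCol {k : Matrix (Fin (m + 1)) (Fin (m + 1)) ℝ}
    (hk : k ∈ SO (m + 1)) (h : lastColCLM m k = EuclideanSpace.single (Fin.last m) 1) :
    cornerBlock (cornerCLM m k) 1 = k ∧ cornerCLM m k ∈ SO m := by
  have hcol : ∀ i, k i (Fin.last m) = if i = Fin.last m then 1 else 0 := by
    intro i
    have := congrArg (fun v : EuclideanSpace ℝ (Fin (m + 1)) => v i) h
    simpa [lastColCLM_apply, Pi.single_apply] using this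
  have hrow : ∀ i, k (Fin.last m) i = if i = Fin.last m then 1 else 0 := by
    intro i
    have := congrFun (congrFun (SO.transpose_mul hk) i) (Fin.last m)
    simpa [mul_apply, hcol, one_apply] using this
  have heq : cornerBlock (cornerCLM m k) 1 = k := by
    apply ext_castSucc_last <;> simp [cornerCLM_apply, hcol, hrow, Fin.castSucc_ne_last]
  refine ⟨heq, ?_⟩
  rw [mem_SO_iff]
  constructor
  · have := SO.transpose_mul hk
    rw [← heq, cornerBlock_transpose, cornerBlock_mul] at this
    have h2 := congrArg (cornerCLM m) this
    rw [cornerCLM_cornerBlock, ← cornerBlock_one, cornerCLM_cornerBlock] at h2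
    exact h2
  · have := (mem_SO_iff.1 hk).2
    rw [← heq, det_cornerBlock, mul_one] at this
    exact this

end Embedding

/-! ### Reflections, used to build explicit sections. -/

section Householder

variable {n : ℕ}

/-- The reflection in the hyperplane orthogonal to `w`. -/
def householder (w : EuclideanSpace ℝ (Fin n)) : Matrix (Fin n) (Fin n) ℝ :=
  1 - (2 / ‖w‖ ^ 2) • vecMulVec w w

theorem dotProduct_self_eq_norm_sq (w : EuclideanSpace ℝ (Fin n)) : w.ofLp ⬝ᵥ w.ofLp = ‖w‖ ^ 2 := by
  rw [← real_inner_self_eq_norm_sq, EuclideanSpace.inner_eq_star_dotProduct, star_trivial]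

theorem householder_transpose (w : EuclideanSpace ℝ (Fin n)) : (householder w)ᵀ = householder w := by
  simp [householder, transpose_vecMulVec]

theorem householder_mul_self {w : EuclideanSpace ℝ (Fin n)} (hw : w ≠ 0) :
    householder w * householder w = 1 := by
  have h : ‖w‖ ^ 2 ≠ 0 := by simpa using hw
  have h2 : vecMulVec w.ofLp w.ofLp * vecMulVec w.ofLp w.ofLp = ‖w‖ ^ 2 • vecMulVec w.ofLp w.ofLp := by
    rw [vecMulVec_mul_vecMulVec, dotProduct_self_eq_norm_sq, vecMulVec_smul]
  rw [householder, sub_mul, mul_sub, mul_sub, smul_mul_smul_comm, h2, smul_smul, mul_one, one_mul,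
    mul_one, show 2 / ‖w‖ ^ 2 * (2 / ‖w‖ ^ 2) * ‖w‖ ^ 2 = 2 / ‖w‖ ^ 2 + 2 / ‖w‖ ^ 2 by
      field_simp; ring, add_smul]
  abel

theorem det_householder {w : EuclideanSpace ℝ (Fin n)} (hw : w ≠ 0) :
    (householder w).det = -1 := by
  have h : ‖w‖ ^ 2 ≠ 0 := by simpa using hw
  have h1 : householder w = 1 - replicateCol (Fin 1) ((2 / ‖w‖ ^ 2) • w.ofLp) *
      replicateRow (Fin 1) w.ofLp := by
    rw [householder, ← smul_vecMulVec, vecMulVec_eq (Fin 1)]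
    rfl
  -- Exchanging the rank one factors reduces the determinant to a 1 × 1 one, with value 1 - 2.
  rw [h1, det_one_sub_mul_comm, det_unique]
  simp only [Matrix.sub_apply, one_apply_eq, replicateRow_mul_replicateCol_apply, dotProduct_smul,
    smul_eq_mul]
  rw [dotProduct_self_eq_norm_sq, div_mul_cancel₀ _ h]
  norm_num

theorem householder_mulVec_of_norm_eq {u v : EuclideanSpace ℝ (Fin n)} (h : ‖u‖ = ‖v‖) (huv : u ≠ v) :
    householder (u - v) *ᵥ v = u.ofLp := by
  have h0 : ‖u - v‖ ^ 2 ≠ 0 := by simpa [sub_eq_zero] using huv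
  have h1 : (u - v).ofLp ⬝ᵥ v.ofLp = -(‖u - v‖ ^ 2 / 2) := by
    have : (u - v).ofLp ⬝ᵥ v.ofLp = inner ℝ v (u - v) := by
      rw [EuclideanSpace.inner_eq_star_dotProduct, star_trivial]
    rw [this, norm_sub_sq_real, inner_sub_right, real_inner_self_eq_norm_sq, h, real_inner_comm]
    ring
  rw [householder, sub_mulVec, one_mulVec, smul_mulVec, vecMulVec_mulVec, h1]
  have h2 : 2 / ‖u - v‖ ^ 2 * -(‖u - v‖ ^ 2 / 2) = -1 := by
    rw [mul_neg, div_mul_div_comm, mul_comm, div_self (mul_ne_zero h0 two_ne_zero)]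
  rw [op_smul_eq_smul, smul_smul, h2]
  ext i
  simp

theorem householder_mul_mem_SO {u v : EuclideanSpace ℝ (Fin n)} (hu : u ≠ 0) (hv : v ≠ 0) :
    householder u * householder v ∈ SO n := by
  rw [mem_SO_iff, transpose_mul, householder_transpose, householder_transpose, det_mul,
    det_householder hu, det_householder hv]
  refine ⟨?_, by norm_num⟩
  rw [Matrix.mul_assoc, ← Matrix.mul_assoc (householder u), householder_mul_self hu,
    Matrix.one_mul, householder_mul_self hv]

theorem contDiffAt_householder {w : EuclideanSpace ℝ (Fin n)} (hw : w ≠ 0) :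
    ContDiffAt ℝ ∞ (householder (n := n)) w := by
  have h : ‖w‖ ^ 2 ≠ 0 := by simpa using hw
  refine contDiffAt_matrix fun i j => ?_
  simp only [householder, Matrix.sub_apply, Matrix.smul_apply, vecMulVec_apply, smul_eq_mul]
  refine contDiffAt_const.sub ((contDiffAt_const.div (contDiff_norm_sq ℝ).contDiffAt h).mul ?_)
  exact ContDiffAt.mul (by fun_prop) (by fun_prop)

end Householder

/-! ### Local triviality of SO_{m+1} → S^m. -/

section Fibration

variable {m : ℕ}

/-- The last basis vector. -/
abbrev lastVec (m : ℕ) : EuclideanSpace ℝ (Fin (m + 1)) := EuclideanSpace.single (Fin.last m) 1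

theorem lastColCLM_one : lastColCLM m 1 = lastVec m := by
  rw [← cornerBlock_one, lastColCLM_cornerBlock]

/-- The projection `SO_{m+1} → S^m`, `k ↦ k e`. -/
def soProj (k : SO (m + 1)) : unitSphere m :=
  ⟨lastColCLM m k, by simpa using norm_lastColCLM_of_mem_SO k.2⟩

theorem continuous_soProj : Continuous (soProj (m := m)) :=
  ((lastColCLM m).continuous.comp continuous_subtype_val).subtype_mk _

theorem sphereChart_ne (f : unitSphere m) (x : EuclideanSpace ℝ (Fin m)) : sphereChart f x ≠ f := by
  have : sphereChart f x ∈ (sphereChart f).target := (sphereChart f).map_source (by simp)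
  simpa using this

theorem sphereChart_sub_ne_zero (f : unitSphere m) (x : EuclideanSpace ℝ (Fin m)) :
    (sphereChart f x : EuclideanSpace ℝ (Fin (m + 1))) - (f : EuclideanSpace ℝ (Fin (m + 1))) ≠ 0 :=
  sub_ne_zero.2 fun h => sphereChart_ne f x (Subtype.ext h)

/-- A local section of `soProj` in stereographic coordinates. -/
def sphereSection (f : unitSphere m) (x : EuclideanSpace ℝ (Fin m)) :
    Matrix (Fin (m + 1)) (Fin (m + 1)) ℝ :=
  householder ((sphereChart f x : EuclideanSpace ℝ (Fin (m + 1))) -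
      (f : EuclideanSpace ℝ (Fin (m + 1)))) *
    householder ((f : EuclideanSpace ℝ (Fin (m + 1))) - lastVec m)

theorem contDiff_sphereChart (f : unitSphere m) :
    ContDiff ℝ ∞ (fun x => (sphereChart f x : EuclideanSpace ℝ (Fin (m + 1)))) := by
  have h := (isLocalParametrization_sphereChart f).contDiffOn
  rwa [sphereChart_source, contDiffOn_univ] at h

theorem contDiff_matrix_mul {V : Type*} [NormedAddCommGroup V] [NormedSpace ℝ V] {n : ℕ}
    {k : ℕ∞ω} {f g : V → Matrix (Fin n) (Fin n) ℝ} {x : V} (hf : ContDiffAt ℝ k f x)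
    (hg : ContDiffAt ℝ k g x) : ContDiffAt ℝ k (fun z => f z * g z) x :=
  ((matrixMulCLM n).contDiff.contDiffAt.comp x hf).clm_apply hg

theorem contDiff_sphereSection (f : unitSphere m) : ContDiff ℝ ∞ (sphereSection f) := by
  refine contDiff_iff_contDiffAt.2 fun x => ?_
  refine contDiff_matrix_mul ?_ contDiffAt_const
  have h : ContDiffAt ℝ ∞ (fun x => (sphereChart f x : EuclideanSpace ℝ (Fin (m + 1))) -
      (f : EuclideanSpace ℝ (Fin (m + 1)))) x :=
    (contDiff_sphereChart f).contDiffAt.sub contDiffAt_const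
  exact ContDiffAt.comp (g := householder) x
    (contDiffAt_householder (sphereChart_sub_ne_zero f x)) h

variable {f : unitSphere m}

theorem norm_lastVec : ‖lastVec m‖ = 1 := by simp

theorem sphereSection_mem (hf : (f : EuclideanSpace ℝ (Fin (m + 1))) ≠ lastVec m)
    (x : EuclideanSpace ℝ (Fin m)) : sphereSection f x ∈ SO (m + 1) :=
  householder_mul_mem_SO (sphereChart_sub_ne_zero f x) (sub_ne_zero.2 hf)

/-- The right-hand reflection sends `lastVec m` to `f`, the left-hand one sends `f` to the point
with coordinate `x`. Two reflections are used so that the determinant is 1, and passing through `f`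
keeps the moving mirror vector nonzero for every `x`. -/
theorem lastColCLM_sphereSection (hf : (f : EuclideanSpace ℝ (Fin (m + 1))) ≠ lastVec m)
    (x : EuclideanSpace ℝ (Fin m)) :
    lastColCLM m (sphereSection f x) = sphereChart f x := by
  have h1 : lastColCLM m (householder ((f : EuclideanSpace ℝ (Fin (m + 1))) - lastVec m)) = f := by
    rw [← Matrix.mul_one (householder _), lastColCLM_mul, lastColCLM_one,
      householder_mulVec_of_norm_eq _ hf]
    rw [norm_lastVec]
    exact norm_eq_of_mem_sphere f
  rw [sphereSection, lastColCLM_mul, h1, householder_mulVec_of_norm_eq]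
  · rw [norm_eq_of_mem_sphere, norm_eq_of_mem_sphere]
  · exact sub_ne_zero.1 (sphereChart_sub_ne_zero f x)

/-- The identity on `SO_m`, extended to all matrices. -/
def toSO (X : Matrix (Fin m) (Fin m) ℝ) : SO m :=
  open scoped Classical in if h : X ∈ SO m then ⟨X, h⟩ else ⟨1, one_mem (specialOrthogonalGroup _ _)⟩

theorem coe_toSO {X : Matrix (Fin m) (Fin m) ℝ} (h : X ∈ SO m) : (toSO X : Matrix _ _ ℝ) = X := by
  simp [toSO, h]

/-- Two elements of the same fibre differ by `sᵀ * k`, which fixes the last basis vector; its corner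
is the fibre coordinate of `k`. -/
theorem SO.corner_of_lastCol_eq {s k : Matrix (Fin (m + 1)) (Fin (m + 1)) ℝ} (hs : s ∈ SO (m + 1))
    (hk : k ∈ SO (m + 1)) (h : lastColCLM m s = lastColCLM m k) :
    cornerCLM m (sᵀ * k) ∈ SO m ∧ s * cornerBlock (cornerCLM m (sᵀ * k)) 1 = k := by
  have h1 : lastColCLM m (sᵀ * k) = lastVec m := by
    rw [lastColCLM_mul, ← h, ← lastColCLM_mul, SO.transpose_mul hs, lastColCLM_one]
  obtain ⟨h2, h3⟩ := eq_cornerBlock_of_lastCol (SO.mul_mem (SO.transpose_mem hs) hk) h1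
  refine ⟨h3, ?_⟩
  rw [h2, ← Matrix.mul_assoc, SO.mul_transpose hs, Matrix.one_mul]

theorem continuous_matrix_mul {X : Type*} [TopologicalSpace X] {n : ℕ}
    {f g : X → Matrix (Fin n) (Fin n) ℝ} {s : Set X} (hf : ContinuousOn f s)
    (hg : ContinuousOn g s) : ContinuousOn (fun z => f z * g z) s :=
  ((matrixMulCLM n).continuous.comp_continuousOn hf).clm_apply hg

theorem soProj_sphereSection_mul (hf : (f : EuclideanSpace ℝ (Fin (m + 1))) ≠ lastVec m)
    {x : EuclideanSpace ℝ (Fin m)} {h : Matrix (Fin m) (Fin m) ℝ}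
    (hk : sphereSection f x * cornerBlock h 1 ∈ SO (m + 1)) :
    soProj ⟨sphereSection f x * cornerBlock h 1, hk⟩ = sphereChart f x := by
  refine Subtype.ext ?_
  simp only [soProj]
  rw [lastColCLM_mul_cornerBlock, lastColCLM_sphereSection hf]

theorem lastColCLM_sphereSection_symm (hf : (f : EuclideanSpace ℝ (Fin (m + 1))) ≠ lastVec m)
    {k : SO (m + 1)} (hk : soProj k ∈ ({f}ᶜ : Set (unitSphere m))) :
    lastColCLM m (sphereSection f ((sphereChart f).symm (soProj k))) = lastColCLM m k := by
  rw [lastColCLM_sphereSection hf, (sphereChart f).right_inv (by simpa using hk)]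
  rfl

theorem continuous_cornerBlock_one :
    Continuous fun h : Matrix (Fin m) (Fin m) ℝ => cornerBlock h 1 := by
  have h := (cornerBlockCLM m).continuous.add (continuous_const (y := cornerBlock 0 1))
  exact h.congr fun X => (cornerBlock_one_eq X).symm

/-- The local trivialization `ℝ^m × SO_m → SO_{m+1}` of `soProj` over the complement of `f`. -/
def soTrivialization (hf : (f : EuclideanSpace ℝ (Fin (m + 1))) ≠ lastVec m) :
    OpenPartialHomeomorph (EuclideanSpace ℝ (Fin m) × SO m) (SO (m + 1)) where
  toFun p := ⟨sphereSection f p.1 * cornerBlock p.2 1,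
    SO.mul_mem (sphereSection_mem hf _) (cornerBlock_mem_SO p.2.2)⟩
  invFun k := ((sphereChart f).symm (soProj k),
    toSO (cornerCLM m ((sphereSection f ((sphereChart f).symm (soProj k)))ᵀ * k)))
  source := univ
  target := soProj ⁻¹' {f}ᶜ
  map_source' := fun p _ => by
    rw [mem_preimage, soProj_sphereSection_mul hf]
    exact sphereChart_ne f p.1
  map_target' := fun _ _ => mem_univ _
  left_inv' := fun p _ => by
    have h1 : (sphereChart f).symm (sphereChart f p.1) = p.1 := (sphereChart f).left_inv (by simp)
    rw [soProj_sphereSection_mul hf, h1]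
    refine Prod.ext rfl (Subtype.ext ?_)
    have h2 : cornerCLM m ((sphereSection f p.1)ᵀ * (sphereSection f p.1 * cornerBlock p.2 1)) =
        (p.2 : Matrix _ _ ℝ) := by
      rw [← Matrix.mul_assoc, SO.transpose_mul (sphereSection_mem hf _), Matrix.one_mul,
        cornerCLM_cornerBlock]
    dsimp only
    rw [h2, coe_toSO p.2.2]
  right_inv' := fun k hk => by
    have h1 := lastColCLM_sphereSection_symm hf hk
    obtain ⟨h2, h3⟩ := SO.corner_of_lastCol_eq (sphereSection_mem hf _) k.2 h1
    refine Subtype.ext ?_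
    dsimp only
    rw [coe_toSO h2, h3]
  open_source := isOpen_univ
  open_target := isOpen_compl_singleton.preimage continuous_soProj
  continuousOn_toFun := by
    refine (Topology.IsInducing.subtypeVal.continuousOn_iff).2 ?_
    refine continuous_matrix_mul ?_ ?_
    · exact ((contDiff_sphereSection f).continuous.comp continuous_fst).continuousOn
    · exact (continuous_cornerBlock_one.comp
        (continuous_subtype_val.comp continuous_snd)).continuousOn
  continuousOn_invFun := by
    have h1 : ContinuousOn (fun k : SO (m + 1) => (sphereChart f).symm (soProj k))
        (soProj ⁻¹' {f}ᶜ) :=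
      (sphereChart f).continuousOn_symm.comp continuous_soProj.continuousOn
        (fun k hk => by simpa using hk)
    refine h1.prodMk ((Topology.IsInducing.subtypeVal.continuousOn_iff).2 ?_)
    have h2 : ContinuousOn (fun k : SO (m + 1) => cornerCLM m
        ((sphereSection f ((sphereChart f).symm (soProj k)))ᵀ * k)) (soProj ⁻¹' {f}ᶜ) := by
      refine (cornerCLM m).continuous.comp_continuousOn (continuous_matrix_mul ?_ ?_)
      · exact ((transposeCLM _).continuous.comp
          (contDiff_sphereSection f).continuous).comp_continuousOn h1
      · exact continuous_subtype_val.continuousOn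
    refine h2.congr fun k hk => ?_
    exact coe_toSO (SO.corner_of_lastCol_eq (sphereSection_mem hf _) k.2
      (lastColCLM_sphereSection_symm hf hk)).1

end Fibration

/-! ### Product charts of SO_{m+1} and the metric in them. -/

section ProductChart

variable {m : ℕ}

/-- The right translates to the identity of the tangent vectors given by a chart of `SO_m` are all
skew matrices. -/
theorem exists_lift_skew
    {e : OpenPartialHomeomorph (EuclideanSpace ℝ (Fin (m * (m - 1) / 2))) (SO m)}
    (he : IsLocalParametrization e) {y : EuclideanSpace ℝ (Fin (m * (m - 1) / 2))}
    (hy : y ∈ e.source) :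
    ∃ T : skewSubmodule m →ₗ[ℝ] EuclideanSpace ℝ (Fin (m * (m - 1) / 2)), ∀ S,
      fderiv ℝ (fun y => (e y : Matrix (Fin m) (Fin m) ℝ)) y (T S) *
        (e y : Matrix (Fin m) (Fin m) ℝ)ᵀ = S := by
  have hskew := fderiv_mul_transpose_skew (he.hasFDerivAt hy)
    (Eventually.of_forall fun z => SO.mul_transpose (e z).2)
  set D := fderiv ℝ (fun y => (e y : Matrix (Fin m) (Fin m) ℝ)) y with hD
  let R : EuclideanSpace ℝ (Fin (m * (m - 1) / 2)) →ₗ[ℝ] skewSubmodule m :=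
    { toFun := fun w => ⟨D w * (e y : Matrix (Fin m) (Fin m) ℝ)ᵀ, hskew w⟩
      map_add' := fun v w => Subtype.ext (by simp [add_mul])
      map_smul' := fun c w => Subtype.ext (by simp) }
  have hR : Function.Injective R := by
    intro v w hvw
    have h1 : D v * (e y : Matrix (Fin m) (Fin m) ℝ)ᵀ = D w * (e y : Matrix (Fin m) (Fin m) ℝ)ᵀ := congrArg Subtype.val hvw
    have h2 := congrArg (fun X => X * (e y : Matrix (Fin m) (Fin m) ℝ)) h1
    simp only [Matrix.mul_assoc, SO.transpose_mul (e y).2, Matrix.mul_one] at h2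
    exact he.injective_fderiv y hy h2
  -- A dimension count makes the injection `R` onto: every skew matrix is a translated tangent
  -- vector.
  have hrank : Module.finrank ℝ (EuclideanSpace ℝ (Fin (m * (m - 1) / 2))) =
      Module.finrank ℝ (skewSubmodule m) := by
    refine le_antisymm (LinearMap.finrank_le_finrank_of_injective hR) ?_
    rw [finrank_euclideanSpace_fin]
    exact finrank_skewSubmodule_le m
  let Re := LinearEquiv.ofInjectiveOfFinrankEq R hR hrank
  refine ⟨Re.symm, fun S => ?_⟩
  have : R (Re.symm S) = S := Re.apply_symm_apply S
  exact congrArg Subtype.val this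

variable {f : unitSphere m}

/-- The chart of `SO_{m+1}` obtained from the stereographic chart of `S^m` and a chart of `SO_m`. -/
def productChart {d : ℕ} (hf : (f : EuclideanSpace ℝ (Fin (m + 1))) ≠ lastVec m)
    (e : OpenPartialHomeomorph (EuclideanSpace ℝ (Fin d)) (SO m)) :
    OpenPartialHomeomorph (EuclideanSpace ℝ (Fin (m + d))) (SO (m + 1)) :=
  (euclideanSplit m d).toHomeomorph.toOpenPartialHomeomorph.trans
    (((OpenPartialHomeomorph.refl _).prod e).trans (soTrivialization hf))

theorem mem_productChart_source {d : ℕ} (hf : (f : EuclideanSpace ℝ (Fin (m + 1))) ≠ lastVec m)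
    (e : OpenPartialHomeomorph (EuclideanSpace ℝ (Fin d)) (SO m))
    {z : EuclideanSpace ℝ (Fin (m + d))} :
    z ∈ (productChart hf e).source ↔ (euclideanSplit m d z).2 ∈ e.source := by
  simp [productChart, soTrivialization]

/-- The derivative of a product chart. -/
def productChartDeriv {d : ℕ} (f : unitSphere m)
    (e : OpenPartialHomeomorph (EuclideanSpace ℝ (Fin d)) (SO m))
    (z : EuclideanSpace ℝ (Fin (m + d))) :
    EuclideanSpace ℝ (Fin (m + d)) →L[ℝ] Matrix (Fin (m + 1)) (Fin (m + 1)) ℝ :=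
  (matrixMulCLM _ (sphereSection f (euclideanSplit m d z).1)).comp
    ((cornerBlockCLM m).comp ((fderiv ℝ (fun y => (e y : Matrix (Fin m) (Fin m) ℝ))
      (euclideanSplit m d z).2).comp ((ContinuousLinearMap.snd ℝ _ _).comp
        (euclideanSplit m d).toContinuousLinearMap))) +
  ((matrixMulCLM _).flip (cornerBlock (e (euclideanSplit m d z).2) 1)).comp
    ((fderiv ℝ (sphereSection f) (euclideanSplit m d z).1).comp
      ((ContinuousLinearMap.fst ℝ _ _).comp (euclideanSplit m d).toContinuousLinearMap))

theorem productChartDeriv_apply {d : ℕ} (f : unitSphere m)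
    (e : OpenPartialHomeomorph (EuclideanSpace ℝ (Fin d)) (SO m))
    (z ζ : EuclideanSpace ℝ (Fin (m + d))) :
    productChartDeriv f e z ζ =
      sphereSection f (euclideanSplit m d z).1 *
          cornerBlock (fderiv ℝ (fun y => (e y : Matrix (Fin m) (Fin m) ℝ))
            (euclideanSplit m d z).2 (euclideanSplit m d ζ).2) 0 +
        fderiv ℝ (sphereSection f) (euclideanSplit m d z).1 (euclideanSplit m d ζ).1 *
          cornerBlock (e (euclideanSplit m d z).2) 1 := rfl

theorem hasFDerivAt_productChart {d : ℕ}
    (hf : (f : EuclideanSpace ℝ (Fin (m + 1))) ≠ lastVec m)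
    {e : OpenPartialHomeomorph (EuclideanSpace ℝ (Fin d)) (SO m)} (he : IsLocalParametrization e)
    {z : EuclideanSpace ℝ (Fin (m + d))} (hz : (euclideanSplit m d z).2 ∈ e.source) :
    HasFDerivAt (fun z => (productChart hf e z : Matrix (Fin (m + 1)) (Fin (m + 1)) ℝ))
      (productChartDeriv f e z) z := by
  have h1 : HasFDerivAt (fun z => sphereSection f (euclideanSplit m d z).1)
      ((fderiv ℝ (sphereSection f) (euclideanSplit m d z).1).comp
      ((ContinuousLinearMap.fst ℝ _ _).comp (euclideanSplit m d).toContinuousLinearMap)) z :=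
    ((contDiff_sphereSection f).differentiable (by simp) _).hasFDerivAt.comp z
      ((ContinuousLinearMap.fst ℝ _ _).comp
        (euclideanSplit m d).toContinuousLinearMap).hasFDerivAt
  have h2 : HasFDerivAt (fun z => cornerBlockCLM m (e (euclideanSplit m d z).2))
      ((cornerBlockCLM m).comp ((fderiv ℝ (fun y => (e y : Matrix (Fin m) (Fin m) ℝ))
      (euclideanSplit m d z).2).comp ((ContinuousLinearMap.snd ℝ _ _).comp
        (euclideanSplit m d).toContinuousLinearMap))) z :=
    (cornerBlockCLM m).hasFDerivAt.comp z (HasFDerivAt.comp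
      (g := fun y => (e y : Matrix (Fin m) (Fin m) ℝ)) z (he.hasFDerivAt hz)
      ((ContinuousLinearMap.snd ℝ _ _).comp
        (euclideanSplit m d).toContinuousLinearMap).hasFDerivAt)
  have h3 : HasFDerivAt (fun z => cornerBlock (e (euclideanSplit m d z).2 : Matrix _ _ ℝ) 1)
      ((cornerBlockCLM m).comp ((fderiv ℝ (fun y => (e y : Matrix (Fin m) (Fin m) ℝ))
      (euclideanSplit m d z).2).comp ((ContinuousLinearMap.snd ℝ _ _).comp
        (euclideanSplit m d).toContinuousLinearMap))) z := by
    refine (h2.add_const (cornerBlock 0 1)).congr_of_eventuallyEq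
      (Eventually.of_forall fun z => ?_)
    exact cornerBlock_one_eq _
  exact h1.matrix_mul h3

/-- The invariant metric of `SO_{m+1}` in a product chart. -/
theorem exists_traceForm_productChartDeriv
    (hf : (f : EuclideanSpace ℝ (Fin (m + 1))) ≠ lastVec m)
    {e : OpenPartialHomeomorph (EuclideanSpace ℝ (Fin (m * (m - 1) / 2))) (SO m)}
    (he : IsLocalParametrization e) {z : EuclideanSpace ℝ (Fin (m + m * (m - 1) / 2))}
    (hz : (euclideanSplit m _ z).2 ∈ e.source) :
    ∃ B : EuclideanSpace ℝ (Fin m) →ₗ[ℝ] EuclideanSpace ℝ (Fin (m * (m - 1) / 2)), ∀ ζ ξ,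
      traceForm (productChartDeriv f e z ζ) (productChartDeriv f e z ξ) =
        2 * inner ℝ (fderiv ℝ (fun x => (sphereChart f x : EuclideanSpace ℝ (Fin (m + 1))))
            (euclideanSplit m _ z).1 (euclideanSplit m _ ζ).1)
          (fderiv ℝ (fun x => (sphereChart f x : EuclideanSpace ℝ (Fin (m + 1))))
            (euclideanSplit m _ z).1 (euclideanSplit m _ ξ).1) +
        traceForm (fderiv ℝ (fun y => (e y : Matrix (Fin m) (Fin m) ℝ)) (euclideanSplit m _ z).2
            ((euclideanSplit m _ ζ).2 + B (euclideanSplit m _ ζ).1))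
          (fderiv ℝ (fun y => (e y : Matrix (Fin m) (Fin m) ℝ)) (euclideanSplit m _ z).2
            ((euclideanSplit m _ ξ).2 + B (euclideanSplit m _ ξ).1)) := by
  obtain ⟨T, hT⟩ := exists_lift_skew he hz
  set x := (euclideanSplit m (m * (m - 1) / 2) z).1 with hx
  set y := (euclideanSplit m (m * (m - 1) / 2) z).2 with hy
  set s := sphereSection f x with hs
  set s' := fderiv ℝ (sphereSection f) x with hs'
  set h : Matrix (Fin m) (Fin m) ℝ := (e y).1 with hh
  set h' := fderiv ℝ (fun y => (e y : Matrix (Fin m) (Fin m) ℝ)) y with hh'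
  have hsmem : s ∈ SO (m + 1) := sphereSection_mem hf x
  have hhmem : h ∈ SO m := (e y).2
  have hsd : HasFDerivAt (sphereSection f) s' x :=
    ((contDiff_sphereSection f).differentiable (by simp) x).hasFDerivAt
  have hskew₁ : ∀ v, (sᵀ * s' v)ᵀ = -(sᵀ * s' v) := transpose_mul_fderiv_skew hsd
    (Eventually.of_forall fun z => SO.transpose_mul (sphereSection_mem hf z))
  have hskew₂ : ∀ w, (h' w * hᵀ)ᵀ = -(h' w * hᵀ) := fderiv_mul_transpose_skew (he.hasFDerivAt hz)
    (Eventually.of_forall fun z => SO.mul_transpose (e z).2)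
  have hcorner : ∀ X : Matrix (Fin (m + 1)) (Fin (m + 1)) ℝ, Xᵀ = -X →
      cornerCLM m X ∈ skewSubmodule m := by
    intro X hX
    rw [mem_skewSubmodule]
    ext i j
    exact skew_apply hX _ _
  -- The corner of `sᵀ * s' v` is the vertical drift of the section. It is skew, so `T` realizes it
  -- as a coordinate vector of the chart `e`; that vector is the shear.
  let B : EuclideanSpace ℝ (Fin m) →ₗ[ℝ] EuclideanSpace ℝ (Fin (m * (m - 1) / 2)) :=
    T ∘ₗ
      { toFun := fun v => ⟨cornerCLM m (sᵀ * s' v), hcorner _ (hskew₁ v)⟩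
        map_add' := fun v w => Subtype.ext (by simp [mul_add])
        map_smul' := fun c w => Subtype.ext (by simp) }
  have hB : ∀ v, h' (B v) * hᵀ = cornerCLM m (sᵀ * s' v) := fun v => hT _
  have hcol : ∀ v, lastColCLM m (s' v) =
      fderiv ℝ (fun x => (sphereChart f x : EuclideanSpace ℝ (Fin (m + 1)))) x v := by
    intro v
    have h1 := (lastColCLM m).hasFDerivAt.comp x hsd
    have h2 : (lastColCLM m ∘ sphereSection f) =
        fun x => (sphereChart f x : EuclideanSpace ℝ (Fin (m + 1))) :=
      funext fun x => lastColCLM_sphereSection hf x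
    rw [h2] at h1
    rw [h1.fderiv]
    rfl
  refine ⟨B, fun ζ ξ => ?_⟩
  -- The derivative of s · diag(h, 1) is s · X · diag(h, 1) with `X` skew. The outer factors are
  -- orthogonal and drop out of the trace form, leaving the corner and last column of `X`.
  set X : EuclideanSpace ℝ (Fin (m + m * (m - 1) / 2)) → Matrix (Fin (m + 1)) (Fin (m + 1)) ℝ :=
    fun ζ => sᵀ * s' (euclideanSplit m _ ζ).1 +
      cornerBlock (h' (euclideanSplit m _ ζ).2 * hᵀ) 0 with hX
  have hLX : ∀ ζ, productChartDeriv f e z ζ = s * (X ζ * cornerBlock h 1) := by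
    intro ζ
    rw [productChartDeriv_apply, hX]
    simp only [add_mul, mul_add]
    rw [cornerBlock_mul, Matrix.mul_assoc (h' _), SO.transpose_mul hhmem, mul_one, zero_mul,
      ← Matrix.mul_assoc s (sᵀ * _), ← Matrix.mul_assoc s sᵀ, SO.mul_transpose hsmem,
      Matrix.one_mul]
    exact add_comm _ _
  have hXskew : ∀ ζ, (X ζ)ᵀ = -X ζ := by
    intro ζ
    simp only [hX]
    rw [transpose_add, hskew₁, cornerBlock_transpose, hskew₂, neg_add]
    congr 1
    have := cornerBlock_smul (-1) (h' (euclideanSplit m _ ζ).2 * hᵀ) 0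
    simpa using this
  have hXcorner : ∀ ζ, cornerCLM m (X ζ) =
      h' ((euclideanSplit m _ ζ).2 + B (euclideanSplit m _ ζ).1) * hᵀ := by
    intro ζ
    simp only [hX]
    rw [map_add, cornerCLM_cornerBlock, map_add, add_mul, hB, add_comm]
  have hXcol : ∀ ζ, lastColCLM m (X ζ) = WithLp.toLp 2 (sᵀ *ᵥ
      (fderiv ℝ (fun x => (sphereChart f x : EuclideanSpace ℝ (Fin (m + 1)))) x
        (euclideanSplit m _ ζ).1)) := by
    intro ζ
    simp only [hX]
    rw [map_add, lastColCLM_cornerBlock, lastColCLM_mul, hcol]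
    simp
  have hstt : sᵀᵀ * sᵀ = 1 := by rw [transpose_transpose, SO.mul_transpose hsmem]
  rw [hLX, hLX, traceForm_mul_left (SO.transpose_mul hsmem),
    traceForm_mul_right (SO.mul_transpose (cornerBlock_mem_SO hhmem)),
    traceForm_eq_corner_add_lastCol (hXskew _) (hXskew _), hXcorner, hXcorner, hXcol, hXcol,
    inner_mulVec_of_orthogonal hstt, traceForm_mul_right
      (by rw [transpose_transpose, SO.transpose_mul hhmem])]
  exact add_comm _ _

end ProductChart

/-! ### The volume element of a product chart. -/

section Measure

variable {m : ℕ} {f : unitSphere m}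

/-- Injectivity of the derivative is read off from the metric: a vector in the kernel makes a sum of
two nonnegative terms vanish, which kills the base component first, then the shear, then the fibre
component. -/
theorem isLocalParametrization_productChart
    (hf : (f : EuclideanSpace ℝ (Fin (m + 1))) ≠ lastVec m)
    {e : OpenPartialHomeomorph (EuclideanSpace ℝ (Fin (m * (m - 1) / 2))) (SO m)}
    (he : IsLocalParametrization e) : IsLocalParametrization (productChart hf e) := by
  refine ⟨fun z hz => ContDiffAt.contDiffWithinAt ?_, fun z hz => ?_⟩
  · rw [mem_productChart_source] at hz
    refine contDiff_matrix_mul (f := fun z => sphereSection f (euclideanSplit m _ z).1) ?_ ?_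
    · exact ((contDiff_sphereSection f).comp
        (contDiff_fst.comp (euclideanSplit m _).contDiff)).contDiffAt
    · have h1 : ContDiffAt ℝ ∞ (fun z => (e (euclideanSplit m _ z).2 : Matrix (Fin m) (Fin m) ℝ)) z :=
        ContDiffAt.comp (g := fun y => (e y : Matrix (Fin m) (Fin m) ℝ)) z (he.contDiffAt hz)
          (contDiff_snd.comp (euclideanSplit m _).contDiff).contDiffAt
      have h2 := ((cornerBlockCLM m).contDiff.contDiffAt.comp z h1).add
        (contDiffAt_const (c := cornerBlock 0 1))
      exact h2.congr_of_eventuallyEq (Eventually.of_forall fun z => cornerBlock_one_eq _)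
  · rw [mem_productChart_source] at hz
    rw [(hasFDerivAt_productChart hf he hz).fderiv]
    obtain ⟨B, hB⟩ := exists_traceForm_productChartDeriv hf he hz
    refine (injective_iff_map_eq_zero _).2 fun ζ hζ => ?_
    have h := hB ζ ζ
    rw [hζ] at h
    have h0 : traceForm (0 : Matrix (Fin (m + 1)) (Fin (m + 1)) ℝ) 0 = 0 := by simp [traceForm]
    rw [h0, real_inner_self_eq_norm_sq] at h
    have h1 := traceForm_self_nonneg (fderiv ℝ (fun y => (e y : Matrix (Fin m) (Fin m) ℝ))
      (euclideanSplit m _ z).2 ((euclideanSplit m _ ζ).2 + B (euclideanSplit m _ ζ).1))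
    have h2 := sq_nonneg ‖fderiv ℝ (fun x => (sphereChart f x : EuclideanSpace ℝ (Fin (m + 1))))
            (euclideanSplit m (m * (m - 1) / 2) z).1 (euclideanSplit m (m * (m - 1) / 2) ζ).1‖
    have h3 := traceForm_self_eq_zero (le_antisymm (by linarith) h1)
    have h4 := pow_eq_zero_iff two_ne_zero |>.1 (le_antisymm (by linarith) h2)
    have h5 : (euclideanSplit m (m * (m - 1) / 2) ζ).1 = 0 :=
      (injective_iff_map_eq_zero _).1 ((isLocalParametrization_sphereChart f).injective_fderiv _
        (by simp)) _ (norm_eq_zero.1 h4)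
    rw [h5, map_zero, add_zero] at h3
    have h6 := (injective_iff_map_eq_zero _).1 (he.injective_fderiv _ hz) _ h3
    exact (map_eq_zero_iff _ (euclideanSplit m _).injective).1 (Prod.ext h5 h6)

theorem det_metricMatrix_productChart
    (hf : (f : EuclideanSpace ℝ (Fin (m + 1))) ≠ lastVec m)
    {e : OpenPartialHomeomorph (EuclideanSpace ℝ (Fin (m * (m - 1) / 2))) (SO m)}
    (he : IsLocalParametrization e) {z : EuclideanSpace ℝ (Fin (m + m * (m - 1) / 2))}
    (hz : (euclideanSplit m _ z).2 ∈ e.source) :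
    (metricMatrix traceMetric (productChart hf e) z).det =
      2 ^ m * (metricMatrix (sphereMetric m) (sphereChart f) (euclideanSplit m _ z).1).det *
        (metricMatrix traceMetric e (euclideanSplit m _ z).2).det := by
  obtain ⟨B, hB⟩ := exists_traceForm_productChartDeriv hf he hz
  set D₁ := fderiv ℝ (fun x => (sphereChart f x : EuclideanSpace ℝ (Fin (m + 1))))
    (euclideanSplit m (m * (m - 1) / 2) z).1 with hD₁
  set D₂ := fderiv ℝ (fun y => (e y : Matrix (Fin m) (Fin m) ℝ))
    (euclideanSplit m (m * (m - 1) / 2) z).2 with hD₂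
  have h := det_gramMatrix_of_shear
    (fun ζ ξ => traceForm (productChartDeriv f e z ζ) (productChartDeriv f e z ξ))
    ((2 : ℝ) • (innerₗ (EuclideanSpace ℝ (Fin (m + 1)))).compl₁₂ D₁.toLinearMap D₁.toLinearMap)
    ((traceBilin m).compl₁₂ D₂.toLinearMap D₂.toLinearMap) B hB
  have h1 : metricMatrix traceMetric (productChart hf e) z = gramMatrix
      (fun ζ ξ => traceForm (productChartDeriv f e z ζ) (productChartDeriv f e z ξ)) (.id ℝ _) := by
    ext i j
    rw [metricMatrix, (hasFDerivAt_productChart hf he hz).fderiv]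
    exact traceMetric_eq_traceBilin _ (productChart hf e z).2 _ _
  have h2 : metricMatrix traceMetric e (euclideanSplit m _ z).2 = gramMatrix
      (fun x y => (traceBilin m).compl₁₂ D₂.toLinearMap D₂.toLinearMap x y) (.id ℝ _) := by
    ext i j
    exact traceMetric_eq_traceBilin _ (e _).2 _ _
  have h3 : gramMatrix (fun x y => ((2 : ℝ) • (innerₗ (EuclideanSpace ℝ (Fin (m + 1)))).compl₁₂
      D₁.toLinearMap D₁.toLinearMap) x y) (.id ℝ _) =
      (2 : ℝ) • metricMatrix (sphereMetric m) (sphereChart f) (euclideanSplit m _ z).1 := by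
    ext i j
    rfl
  rw [h1, h2, h, h3, det_smul, Fintype.card_fin]

theorem sqrt_two_pow (m : ℕ) : √((2 : ℝ) ^ m) = (2 : ℝ) ^ ((m : ℝ) / 2) := by
  rw [Real.sqrt_eq_rpow, ← Real.rpow_natCast, ← Real.rpow_mul zero_le_two]
  congr 1
  ring

/-- The volume measure of `SO_{m+1}` in a product chart. -/
theorem chartVolume_productChart
    (hf : (f : EuclideanSpace ℝ (Fin (m + 1))) ≠ lastVec m)
    {e : OpenPartialHomeomorph (EuclideanSpace ℝ (Fin (m * (m - 1) / 2))) (SO m)}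
    (he : IsLocalParametrization e) {Q : Set (SO (m + 1))} (hQ : MeasurableSet Q)
    {A : Set (unitSphere m)} (hA : MeasurableSet A) {S : Set (SO m)} (hS : MeasurableSet S)
    (h : (productChart hf e).source ∩ productChart hf e ⁻¹' Q =
      euclideanSplit m _ ⁻¹' ((sphereChart f ⁻¹' A) ×ˢ (e.source ∩ e ⁻¹' S))) :
    chartVolume traceMetric (productChart hf e) Q =
      ENNReal.ofReal ((2 : ℝ) ^ ((m : ℝ) / 2)) *
        chartVolume (sphereMetric m) (sphereChart f) A * chartVolume traceMetric e S := by
  have hg₁ : ∀ p ∈ unitSphere m, ∀ X Y, sphereMetric m p X Y =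
      innerₗ (EuclideanSpace ℝ (Fin (m + 1))) X Y := fun _ _ _ _ => rfl
  have hA' : MeasurableSet (sphereChart f ⁻¹' A) := by
    have := (sphereChart f).continuousOn.measurableSet_inter_preimage
      (sphereChart f).open_source.measurableSet hA
    simpa using this
  have hS' : MeasurableSet (e.source ∩ e ⁻¹' S) :=
    e.continuousOn.measurableSet_inter_preimage e.open_source.measurableSet hS
  have hc₁ := (isLocalParametrization_sphereChart f).continuousOn_sqrt_det_metricMatrix hg₁
  have hc₂ := he.continuousOn_sqrt_det_metricMatrix traceMetric_eq_traceBilin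
  have hm₁ : AEMeasurable (fun x => ENNReal.ofReal
      √(metricMatrix (sphereMetric m) (sphereChart f) x).det)
      (volume.restrict (sphereChart f ⁻¹' A)) :=
    ((hc₁.mono (by simp)).aemeasurable hA').ennreal_ofReal
  have hm₂ : AEMeasurable (fun x => ENNReal.ofReal √(metricMatrix traceMetric e x).det)
      (volume.restrict (e.source ∩ e ⁻¹' S)) :=
    ((hc₂.mono inter_subset_left).aemeasurable hS').ennreal_ofReal
  rw [chartVolume_apply _ hQ, h, chartVolume_apply _ hA, chartVolume_apply _ hS, sphereChart_source,
    univ_inter, mul_assoc, ← setLIntegral_euclideanSplit hm₁ hm₂,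
    ← lintegral_const_mul' _ _ ENNReal.ofReal_ne_top]
  refine setLIntegral_congr_fun ((euclideanSplit m _).continuous.measurable (hA'.prod hS'))
    fun z hz => ?_
  have hz2 : (euclideanSplit m _ z).2 ∈ e.source := hz.2.1
  have hnn : 0 ≤ (metricMatrix (sphereMetric m) (sphereChart f)
      (euclideanSplit m (m * (m - 1) / 2) z).1).det :=
    (posSemidef_gram ℝ fun i => fderiv ℝ (fun x => (sphereChart f x :
      EuclideanSpace ℝ (Fin (m + 1)))) (euclideanSplit m (m * (m - 1) / 2) z).1
        (EuclideanSpace.single i 1)).det_nonneg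
  simp only [det_metricMatrix_productChart hf he hz2]
  rw [Real.sqrt_mul (mul_nonneg (by positivity) hnn), Real.sqrt_mul (by positivity), sqrt_two_pow,
    ENNReal.ofReal_mul (by positivity), ENNReal.ofReal_mul (by positivity), mul_assoc]

end Measure

/-! ### From local product formulas to the recursion and the closed formula. -/

section Recursion

variable {m : ℕ} {f : unitSphere m}

/-- The charts of dimension `d` cover `M`. -/
def CoveredByCharts {E : Type*} [NormedAddCommGroup E] [NormedSpace ℝ E] (d : ℕ) (M : Set E) :
    Prop :=
  ∀ p : M, ∃ e : OpenPartialHomeomorph (EuclideanSpace ℝ (Fin d)) M,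
    IsLocalParametrization e ∧ p ∈ e.target

theorem secondCountableTopology_subtype {E : Type*} [NormedAddCommGroup E] [NormedSpace ℝ E]
    [FiniteDimensional ℝ E] (M : Set E) : SecondCountableTopology M := by
  have : ProperSpace E := FiniteDimensional.proper_real E
  infer_instance

theorem mem_productChart_target {d : ℕ} (hf : (f : EuclideanSpace ℝ (Fin (m + 1))) ≠ lastVec m)
    (e : OpenPartialHomeomorph (EuclideanSpace ℝ (Fin d)) (SO m)) {k : SO (m + 1)} :
    k ∈ (productChart hf e).target ↔
      soProj k ≠ f ∧ ((soTrivialization hf).symm k).2 ∈ e.target := by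
  simp [productChart, soTrivialization]

/-- The pole of the projection must avoid both `p` and `lastVec m`. This needs a third point on the
sphere, so it fails on S^0; the candidates are the first basis vector and `-lastVec m`. -/
theorem exists_ne_lastVec (hm : 1 ≤ m) (p : unitSphere m) :
    ∃ f : unitSphere m, (f : EuclideanSpace ℝ (Fin (m + 1))) ≠ lastVec m ∧ p ≠ f := by
  have h0 : (0 : Fin (m + 1)) ≠ Fin.last m := fun h => by
    have := congrArg Fin.val h
    simp at this
    omega
  have hne : EuclideanSpace.single (0 : Fin (m + 1)) (1 : ℝ) ≠ lastVec m := fun h => by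
    have := congrArg (fun v : EuclideanSpace ℝ (Fin (m + 1)) => v 0) h
    simp [h0] at this
  by_cases hp : (p : EuclideanSpace ℝ (Fin (m + 1))) = EuclideanSpace.single 0 1
  · refine ⟨⟨-lastVec m, by simp⟩, fun h => ?_, fun h => ?_⟩
    · have := congrArg (fun v : EuclideanSpace ℝ (Fin (m + 1)) => v (Fin.last m)) h
      norm_num at this
    · rw [h] at hp
      have := congrArg (fun v : EuclideanSpace ℝ (Fin (m + 1)) => v 0) hp
      simp [h0] at this
  · exact ⟨⟨EuclideanSpace.single 0 1, by simp⟩, hne, fun h => hp (by rw [h])⟩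

theorem coveredByCharts_SO_succ (hm : 1 ≤ m) (h : CoveredByCharts (m * (m - 1) / 2) (SO m)) :
    CoveredByCharts (m + m * (m - 1) / 2) (SO (m + 1)) := by
  intro k
  obtain ⟨f, hf, hkf⟩ := exists_ne_lastVec hm (soProj k)
  obtain ⟨e, he, hke⟩ := h ((soTrivialization hf).symm k).2
  exact ⟨productChart hf e, isLocalParametrization_productChart hf he,
    (mem_productChart_target hf e).2 ⟨hkf, hke⟩⟩

/-- The volume of the part of `SO_{m+1}` over a subset of the sphere avoiding `f`. -/
theorem riemannianMeasure_SO_preimage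
    (hf : (f : EuclideanSpace ℝ (Fin (m + 1))) ≠ lastVec m)
    (hcov : CoveredByCharts (m * (m - 1) / 2) (SO m)) {A : Set (unitSphere m)}
    (hA : MeasurableSet A) (hAf : A ⊆ {f}ᶜ) :
    riemannianMeasure (m + m * (m - 1) / 2) (SO (m + 1)) traceMetric (soProj ⁻¹' A) =
      ENNReal.ofReal ((2 : ℝ) ^ ((m : ℝ) / 2)) * volSO m *
        riemannianMeasure m (unitSphere m) (sphereMetric m) A := by
  have hg₁ : ∀ p ∈ unitSphere m, ∀ X Y, sphereMetric m p X Y =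
      innerₗ (EuclideanSpace ℝ (Fin (m + 1))) X Y := fun _ _ _ _ => rfl
  have := secondCountableTopology_subtype (SO m)
  set μ := riemannianMeasure (m + m * (m - 1) / 2) (SO (m + 1)) traceMetric
  set ψ := soTrivialization hf with hψ
  have hψt : ψ.target = soProj ⁻¹' {f}ᶜ := rfl
  set r : SO (m + 1) → SO m := fun k => (ψ.symm k).2 with hr
  have hrc : ContinuousOn r ψ.target := continuous_snd.comp_continuousOn ψ.continuousOn_symm
  have hAm : MeasurableSet (soProj ⁻¹' A) := continuous_soProj.measurable hA
  have hAt : soProj ⁻¹' A ⊆ ψ.target := preimage_mono hAf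
  have hrm : AEMeasurable r (μ.restrict (soProj ⁻¹' A)) :=
    (hrc.mono hAt).aemeasurable hAm
  have key : (μ.restrict (soProj ⁻¹' A)).map r =
      (ENNReal.ofReal ((2 : ℝ) ^ ((m : ℝ) / 2)) *
        riemannianMeasure m (unitSphere m) (sphereMetric m) A) •
          riemannianMeasure (m * (m - 1) / 2) (SO m) traceMetric := by
    -- SO_m need not be a single chart domain, so the part over `A` is pushed to the fibre by `r`
    -- and compared there chart by chart; total masses are taken only afterwards.
    choose e he hmem using hcov
    refine Measure.ext_of_forall_open_cover (fun h => (e h).target) (fun h => (e h).open_target)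
      hmem fun h S hS hSm => ?_
    have hQm : MeasurableSet (soProj ⁻¹' A ∩ r ⁻¹' S) :=
      (hrc.mono hAt).measurableSet_inter_preimage hAm hSm
    have hQt : soProj ⁻¹' A ∩ r ⁻¹' S ⊆ (productChart hf (e h)).target := fun k hk =>
      (mem_productChart_target hf _).2 ⟨hAf hk.1, hS hk.2⟩
    rw [Measure.map_apply_of_aemeasurable hrm hSm, Measure.restrict_apply' hAm, inter_comm,
      riemannianMeasure_apply_of_subset_target traceMetric_eq_traceBilin
        (isLocalParametrization_productChart hf (he h)) hQm hQt,
      chartVolume_productChart hf (he h) hQm hA hSm, Measure.smul_apply, smul_eq_mul,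
      riemannianMeasure_apply_of_subset_target traceMetric_eq_traceBilin (he h) hSm hS,
      riemannianMeasure_apply_of_subset_target hg₁ (isLocalParametrization_sphereChart f) hA
        (by simpa using hAf)]
    ext z
    have h1 : soProj (productChart hf (e h) z) = sphereChart f (euclideanSplit m _ z).1 :=
      soProj_sphereSection_mul hf _
    have h2 : r (productChart hf (e h) z) = e h (euclideanSplit m _ z).2 :=
      congrArg Prod.snd (ψ.left_inv (x := ((euclideanSplit m _ z).1, e h (euclideanSplit m _ z).2))
        (mem_univ _))
    simp only [mem_inter_iff, mem_productChart_source, mem_preimage, mem_prod, h1, h2]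
    tauto
  have h := congrArg (fun ν => ν univ) key
  simp only [Measure.map_apply_of_aemeasurable hrm MeasurableSet.univ, preimage_univ,
    Measure.restrict_apply_univ, Measure.smul_apply, smul_eq_mul] at h
  rw [h, mul_right_comm]
  rfl

/-- Identifies the dimension of SO_{m+1} in `volSO` with base plus fibre dimension, as product
charts have it. -/
theorem succ_mul_div_two (m : ℕ) : (m + 1) * (m + 1 - 1) / 2 = m + m * (m - 1) / 2 := by
  have h := Nat.triangle_succ m
  simp only [Nat.add_sub_cancel] at h ⊢
  rw [h, add_comm]

/-- The image of the measure of SO_{m+1} under `soProj` is a constant multiple of the measure of the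
sphere, since this holds over each `{f p}ᶜ` with the same constant. -/
theorem volSO_succ (hm : 1 ≤ m) (hcov : CoveredByCharts (m * (m - 1) / 2) (SO m)) :
    volSO (m + 1) = volSO m * volSphere m * ENNReal.ofReal ((2 : ℝ) ^ ((m : ℝ) / 2)) := by
  have := secondCountableTopology_subtype (unitSphere m)
  have key : (riemannianMeasure (m + m * (m - 1) / 2) (SO (m + 1)) traceMetric).map soProj =
      (ENNReal.ofReal ((2 : ℝ) ^ ((m : ℝ) / 2)) * volSO m) •
        riemannianMeasure m (unitSphere m) (sphereMetric m) := by
    choose f hf hpf using exists_ne_lastVec hm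
    refine Measure.ext_of_forall_open_cover (fun p => {f p}ᶜ) (fun p => isOpen_compl_singleton)
      hpf fun p A hAf hA => ?_
    rw [Measure.map_apply continuous_soProj.measurable hA,
      riemannianMeasure_SO_preimage (hf p) hcov hA hAf, Measure.smul_apply, smul_eq_mul]
  have h := congrArg (fun ν => ν univ) key
  simp only [Measure.map_apply continuous_soProj.measurable MeasurableSet.univ, preimage_univ,
    Measure.smul_apply, smul_eq_mul] at h
  rw [volSO, succ_mul_div_two]
  refine Eq.trans h ?_
  rw [mul_assoc, mul_comm]
  rfl

theorem subsingleton_SO_one : Subsingleton (SO 1) := by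
  refine ⟨fun k l => Subtype.ext ?_⟩
  have hk := (mem_SO_iff.1 k.2).2
  have hl := (mem_SO_iff.1 l.2).2
  rw [det_fin_one] at hk hl
  ext i j
  rw [Subsingleton.elim i 0, Subsingleton.elim j 0, hk, hl]

/-- The chart of the point `SO_1`. -/
def chartSOOne : OpenPartialHomeomorph (EuclideanSpace ℝ (Fin 0)) (SO 1) :=
  have := subsingleton_SO_one
  have : Unique (SO 1) := uniqueOfSubsingleton ⟨1, one_mem (specialOrthogonalGroup _ _)⟩
  have : Unique (EuclideanSpace ℝ (Fin 0)) := uniqueOfSubsingleton 0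
  (Homeomorph.homeomorphOfUnique (EuclideanSpace ℝ (Fin 0)) (SO 1)).toOpenPartialHomeomorph

theorem isLocalParametrization_chartSOOne : IsLocalParametrization chartSOOne := by
  have h : (fun x => (chartSOOne x : Matrix (Fin 1) (Fin 1) ℝ)) =
      fun _ => (chartSOOne 0 : Matrix (Fin 1) (Fin 1) ℝ) :=
    funext fun x => by rw [Subsingleton.elim x 0]
  refine ⟨?_, fun _ _ => Function.injective_of_subsingleton _⟩
  rw [h]
  exact contDiffOn_const

theorem volSO_one : volSO 1 = 1 := by
  have h := riemannianMeasure_apply_of_subset_target traceMetric_eq_traceBilin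
    isLocalParametrization_chartSOOne MeasurableSet.univ (S := univ) (fun _ _ => mem_univ _)
  refine Eq.trans h ?_
  rw [chartVolume_apply _ MeasurableSet.univ]
  have h1 : chartSOOne.source ∩ chartSOOne ⁻¹' univ = univ := by
    rw [preimage_univ, inter_univ]; rfl
  rw [h1]
  -- Lebesgue measure on ℝ^0 is an empty product, a point mass 1, and the empty Gram determinant is
  -- 1.
  have h2 := (PiLp.volume_preserving_ofLp (Fin 0)).measure_preimage
    MeasurableSet.univ.nullMeasurableSet
  rw [preimage_univ, volume_pi, Measure.pi_of_empty] at h2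
  simp [h2]

theorem coveredByCharts_SO {n : ℕ} (hn : 1 ≤ n) : CoveredByCharts (n * (n - 1) / 2) (SO n) := by
  induction n, hn using Nat.le_induction with
  | base => exact fun p => ⟨chartSOOne, isLocalParametrization_chartSOOne, mem_univ _⟩
  | succ m hm ih =>
    rw [succ_mul_div_two]
    exact coveredByCharts_SO_succ hm ih

theorem volSO_eq_prod {n : ℕ} (hn : 1 ≤ n) :
    volSO n = ENNReal.ofReal ((2 : ℝ) ^ ((n : ℝ) * ((n : ℝ) - 1) / 4)) *
      ∏ k ∈ Finset.Icc 2 n, volSphere (k - 1) := by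
  induction n, hn using Nat.le_induction with
  | base => simp [volSO_one]
  | succ m hm ih =>
    rw [volSO_succ hm (coveredByCharts_SO hm), ih, Finset.prod_Icc_succ_top (by omega),
      Nat.add_sub_cancel, show (((m + 1 : ℕ) : ℝ) * (((m + 1 : ℕ) : ℝ) - 1) / 4) =
        (m : ℝ) * ((m : ℝ) - 1) / 4 + (m : ℝ) / 2 by push_cast; ring,
      Real.rpow_add zero_lt_two, ENNReal.ofReal_mul (by positivity)]
    ring

end Recursion

end

theorem lemma4p13 :
    (∀ n : ℕ, 2 ≤ n →
      volSO n = volSO (n - 1) * volSphere (n - 1) *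
        ENNReal.ofReal ((2 : ℝ) ^ (((n : ℝ) - 1) / 2))) ∧
    (∀ n : ℕ, 1 ≤ n →
      volSO n = ENNReal.ofReal ((2 : ℝ) ^ ((n : ℝ) * ((n : ℝ) - 1) / 4)) *
        ∏ k ∈ Finset.Icc 2 n, volSphere (k - 1) ∧
      volSO n = ENNReal.ofReal ((2 : ℝ) ^ ((n : ℝ) * ((n : ℝ) - 1) / 4) *
        ∏ k ∈ Finset.Icc 2 n, (2 * Real.pi ^ ((k : ℝ) / 2) / Real.Gamma ((k : ℝ) / 2)))) := by
  refine ⟨fun n hn => ?_, fun n hn => ⟨volSO_eq_prod hn, ?_⟩⟩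
  · obtain ⟨m, rfl⟩ : ∃ m, n = m + 1 := ⟨n - 1, by omega⟩
    have hm : 1 ≤ m := by omega
    rw [Nat.add_sub_cancel, volSO_succ hm (coveredByCharts_SO hm), Nat.cast_add_one,
      add_sub_cancel_right]
  · have hpos : ∀ k ∈ Finset.Icc 2 n,
        0 ≤ 2 * Real.pi ^ ((k : ℝ) / 2) / Real.Gamma ((k : ℝ) / 2) := fun k hk => by
      have := Real.Gamma_nonneg_of_nonneg (show (0 : ℝ) ≤ (k : ℝ) / 2 by positivity)
      positivity
    rw [volSO_eq_prod hn, ENNReal.ofReal_mul (by positivity), ENNReal.ofReal_prod_of_nonneg hpos]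
    congr 1
    refine Finset.prod_congr rfl fun k hk => ?_
    rw [volSphere_eq, Nat.sub_add_cancel (by have := (Finset.mem_Icc.1 hk).1; omega)]
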